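/- Definitions. A discrete group $\Gamma$ has the Haagerup property if there is a net of positive definite functions $f_j:\Gamma\to\mathbb{C}$ with $f_j(1)=1$, each vanishing at infinity, such that $f_j\to 1$ pointwise. If $\tau$ is a faithful tracial state on a unital $C^*$-algebra $A$, with GNS space $L^2(A,\tau)$ and $\|a\|_\tau=\tau(a^*a)^{1/2}$, then the pair $(A,\tau)$ has the Haagerup property if there is a net $(\phi_j)$ of unital completely positive maps $A\to A$ such that (1) $\tau(\phi_j(a))\le\tau(a)$ for every $j$ and every $a\ge 0$; (2) $\|\phi_j(a)-a\|_\tau\to 0$ for every $a\in A$; (3) each $\phi_j$ extends to a compact operator on $L^2(A,\tau)$. Theorem. Let $\Gamma$ be a discrete group with the Haagerup property and let $\alpha$ be an action of $\Gamma$ by $*$-automorphisms on a unital $C^*$-algebra $A$. Assume the following. - $A$ has a $\Gamma$-invariant faithful tracial state $\tau$. - $\Gamma$ is the union of an increasing net $(\Gamma_i)_{i\in I}$ of subgroups. - There is an increasing net $(A_i)_{i\in I}$, with the same index set, of finite dimensional (not necessarily unital) $C^*$-subalgebras of $A$ whose union is dense in $A$ for the norm $\|\cdot\|_\tau$, and each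 $A_i$ is $\Gamma_i$-invariant. Then the reduced crossed product $A\rtimes_r\Gamma$ has the Haagerup property with respect to the canonical extension $\tilde\tau$ of $\tau$. That is: let $\pi:A\to B(H)$ be any faithful unital representation, and realize $A\rtimes_r\Gamma$ as the $C^*$-algebra of operators on $\ell^2(\Gamma,H)$ generated by the operators $(a\xi)(g)=\pi(\alpha_{g^{-1}}(a))\xi(g)$ for $a\in A$ and $(u_s\xi)(g)=\xi(s^{-1}g)$ for $s\in\Gamma$. Then there is a faithful tracial state $\tilde\tau$ on $A\rtimes_r\Gamma$ with $\tilde\tau(a u_1)=\tau(a)$ and $\tilde\tau(a u_s)=0$ for all $a\in A$ and $s\ne 1$, and the pair $(A\rtimes_r\Gamma,\tilde\tau)$ has the Haagerup property. -/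

import Mathlib

open Filter Topology
open scoped ComplexOrder ENNReal CStarAlgebra

universe u v w

/-- A positive definite function on a discrete group, normalized to be `1` at the unit. -/
def IsPositiveDefinite {Γ : Type u} [Group Γ] (f : Γ → ℂ) : Prop :=
  f 1 = 1 ∧ (Matrix.of fun s t : Γ => f (s⁻¹ * t)).PosSemidef

/-- The Haagerup property of a discrete group: there is a net of normalized positive definite
functions, each vanishing at infinity, which converges pointwise to `1`.

The index set of the net may be taken in the universe of `Γ` without loss of generality: any such
net yields one indexed by (finite subset of `Γ`, natural number). -/
def GroupHaagerup (Γ : Type u) [Group Γ] : Prop :=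
  ∃ (J : Type u) (_ : Preorder J) (_ : IsDirectedOrder J) (_ : Nonempty J) (f : J → Γ → ℂ),
    (∀ j, IsPositiveDefinite (f j)) ∧
    (∀ j, Tendsto (f j) cofinite (𝓝 0)) ∧
    ∀ g, Tendsto (fun j => f j g) atTop (𝓝 1)

section Trace

variable {A : Type v} [CStarAlgebra A] [PartialOrder A] [StarOrderedRing A]

/-- A faithful tracial state on a unital C*-algebra. -/
structure IsFaithfulTracialState (τ : A →ₚ[ℂ] ℂ) : Prop where
  map_one : τ 1 = 1
  map_mul_comm : ∀ a b, τ (a * b) = τ (b * a)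
  faithful : ∀ a, τ (star a * a) = 0 → a = 0

/-- The map `φ` is `L²`-compact: it extends to a compact bounded operator on `L²(A, τ)`. -/
def IsL2Compact (τ : A →ₚ[ℂ] ℂ) (φ : A →CP A) : Prop :=
  ∃ T : τ.GNS →L[ℂ] τ.GNS,
    (∀ a : A, T (τ.toPreGNS a : τ.GNS) = (τ.toPreGNS (φ a) : τ.GNS)) ∧ IsCompactOperator T

/-- The Haagerup property of a pair `(A, τ)`: `τ` is a faithful tracial state on the unital
C*-algebra `A`, and there is a net of unital completely positive, `τ`-decreasing, `L²`-compact
self-maps of `A` which converges to the identity pointwise in the `L²`-norm.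

The index set of the net may be taken in the universe of `A` without loss of generality: any such
net yields one indexed by (finite subset of `A`, natural number). -/
def HaagerupProperty (τ : A →ₚ[ℂ] ℂ) : Prop :=
  IsFaithfulTracialState τ ∧
  ∃ (J : Type v) (_ : Preorder J) (_ : IsDirectedOrder J) (_ : Nonempty J) (φ : J → (A →CP A)),
    (∀ j, φ j 1 = 1) ∧
    (∀ j, ∀ a : A, 0 ≤ a → τ (φ j a) ≤ τ a) ∧
    (∀ a : A, Tendsto (fun j => ‖τ.toPreGNS (φ j a - a)‖) atTop (𝓝 0)) ∧
    ∀ j, IsL2Compact τ (φ j)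

end Trace

section CrossedProduct

variable {Γ : Type u} [Group Γ] {A : Type v} [CStarAlgebra A]
  {H : Type w} [NormedAddCommGroup H] [InnerProductSpace ℂ H]

/-- The Hilbert space `ℓ²(Γ, H) = H ⊗ ℓ²(Γ)`. -/
abbrev L2Group (Γ : Type u) (H : Type w) [NormedAddCommGroup H] [InnerProductSpace ℂ H] :
    Type (max u w) :=
  lp (fun _ : Γ => H) 2

/-- The left translation operators on `ℓ²(Γ, H)`: `(s ξ)(g) = ξ(s⁻¹ g)`. -/
noncomputable def regularRepGroup (H : Type w) [NormedAddCommGroup H] [InnerProductSpace ℂ H]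
    (s : Γ) : L2Group Γ H →L[ℂ] L2Group Γ H :=
  have mem (ξ : L2Group Γ H) : Memℓp (fun g => ξ (s⁻¹ * g)) 2 :=
    memℓp_gen (((Equiv.mulLeft s⁻¹).summable_iff (f := fun g => ‖ξ g‖ ^ (2 : ℝ≥0∞).toReal)).2
      ((lp.memℓp ξ).summable (by norm_num)))
  LinearMap.mkContinuous
    { toFun := fun ξ => ⟨fun g => ξ (s⁻¹ * g), mem ξ⟩
      map_add' := fun ξ η => by ext g; rfl
      map_smul' := fun c ξ => by ext g; simp }
    1 fun ξ => by
      have h2 : 0 < (2 : ℝ≥0∞).toReal := by norm_num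
      rw [one_mul, lp.norm_eq_tsum_rpow h2, lp.norm_eq_tsum_rpow h2 ξ]
      exact le_of_eq (congrArg (· ^ _)
        ((Equiv.mulLeft s⁻¹).tsum_eq fun g => ‖ξ g‖ ^ (2 : ℝ≥0∞).toReal))

@[simp]
theorem regularRepGroup_apply (s : Γ) (ξ : L2Group Γ H) (g : Γ) :
    regularRepGroup H s ξ g = ξ (s⁻¹ * g) := rfl

variable [CompleteSpace H]

/-- The representation of `A` on `ℓ²(Γ, H)` induced by a representation `π` of `A` on `H`:
`(a ξ)(g) = π(α_g⁻¹(a)) ξ(g)`. -/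
noncomputable def regularRepAlg (α : Γ →* (A ≃⋆ₐ[ℂ] A)) (π : A →⋆ₐ[ℂ] (H →L[ℂ] H)) (a : A) :
    L2Group Γ H →L[ℂ] L2Group Γ H :=
  have bound (ξ : L2Group Γ H) (g : Γ) :
      ‖π (α g⁻¹ a) (ξ g)‖ ≤ ‖(((‖a‖ : ℝ) : ℂ) • ξ : L2Group Γ H) g‖ := by
    have h : ‖π (α g⁻¹ a)‖ ≤ ‖a‖ :=
      (NonUnitalStarAlgHom.norm_apply_le π _).trans (NonUnitalStarAlgHom.norm_apply_le (α g⁻¹) a)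
    rw [lp.coeFn_smul, Pi.smul_apply, norm_smul, Complex.norm_real, norm_norm]
    exact (π (α g⁻¹ a)).le_of_opNorm_le h _
  LinearMap.mkContinuous
    { toFun := fun ξ => ⟨fun g => π (α g⁻¹ a) (ξ g), (lp.memℓp _).mono' (bound ξ)⟩
      map_add' := fun ξ η => by ext g; exact map_add (π (α g⁻¹ a)) (ξ g) (η g)
      map_smul' := fun c ξ => by ext g; simp }
    ‖a‖ fun ξ => by
      refine (lp.norm_mono (by norm_num) (bound ξ)).trans_eq ?_
      rw [norm_smul, Complex.norm_real, norm_norm]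

@[simp]
theorem regularRepAlg_apply (α : Γ →* (A ≃⋆ₐ[ℂ] A)) (π : A →⋆ₐ[ℂ] (H →L[ℂ] H)) (a : A)
    (ξ : L2Group Γ H) (g : Γ) : regularRepAlg α π a ξ g = π (α g⁻¹ a) (ξ g) := rfl

/-- The C*-algebra of operators on `ℓ²(Γ, H)` generated by the copies of `A` and `Γ`. -/
noncomputable def reducedCrossedProductSubalgebra (α : Γ →* (A ≃⋆ₐ[ℂ] A))
    (π : A →⋆ₐ[ℂ] (H →L[ℂ] H)) : StarSubalgebra ℂ (L2Group Γ H →L[ℂ] L2Group Γ H) :=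
  (StarAlgebra.adjoin ℂ
    (Set.range (regularRepAlg α π) ∪ Set.range (regularRepGroup (Γ := Γ) H))).topologicalClosure

/-- The reduced crossed product `A ⋊_{α,r} Γ`, realized on `ℓ²(Γ, H)` by means of a representation
`π` of `A` on `H`. It is the reduced crossed product when `π` is faithful; up to canonical
isomorphism it then does not depend on `π`. -/
def ReducedCrossedProduct (α : Γ →* (A ≃⋆ₐ[ℂ] A)) (π : A →⋆ₐ[ℂ] (H →L[ℂ] H)) :
    Type (max u w) :=
  reducedCrossedProductSubalgebra α π

namespace ReducedCrossedProduct

variable (α : Γ →* (A ≃⋆ₐ[ℂ] A)) (π : A →⋆ₐ[ℂ] (H →L[ℂ] H))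

noncomputable instance : CStarAlgebra (ReducedCrossedProduct α π) :=
  StarSubalgebra.cstarAlgebra (reducedCrossedProductSubalgebra α π)
    (h_closed := StarSubalgebra.isClosed_topologicalClosure _)

/-- The usual order of a C*-algebra: `x ≤ y` if and only if `y - x` is of the form `b* b`. -/
noncomputable instance : PartialOrder (ReducedCrossedProduct α π) :=
  CStarAlgebra.spectralOrder _

instance : StarOrderedRing (ReducedCrossedProduct α π) :=
  CStarAlgebra.spectralOrderedRing _

/-- The canonical copy of `a : A` in the reduced crossed product. -/
noncomputable def ofAlg (a : A) : ReducedCrossedProduct α π :=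
  ⟨regularRepAlg α π a, StarSubalgebra.le_topologicalClosure _
    (StarAlgebra.subset_adjoin ℂ _ (Or.inl ⟨a, rfl⟩))⟩

/-- The canonical unitary implementing `s : Γ` in the reduced crossed product. -/
noncomputable def ofGroup (s : Γ) : ReducedCrossedProduct α π :=
  ⟨regularRepGroup H s, StarSubalgebra.le_topologicalClosure _
    (StarAlgebra.subset_adjoin ℂ _ (Or.inr ⟨s, rfl⟩))⟩

/-- `τ'` is the canonical extension of `τ` to the reduced crossed product, i.e. it is given by
`τ'(∑ a_s u_s) = τ(a_1)` on finite sums (which are dense). -/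
def IsCanonicalExtension {α : Γ →* (A ≃⋆ₐ[ℂ] A)} {π : A →⋆ₐ[ℂ] (H →L[ℂ] H)} [PartialOrder A]
    (τ : A →ₚ[ℂ] ℂ) (τ' : ReducedCrossedProduct α π →ₚ[ℂ] ℂ) : Prop :=
  (∀ a, τ' (ofAlg α π a * ofGroup α π 1) = τ a) ∧
    ∀ a, ∀ s : Γ, s ≠ 1 → τ' (ofAlg α π a * ofGroup α π s) = 0

end ReducedCrossedProduct

end CrossedProduct

set_option linter.unusedSectionVars false

/-! ### Positive elements and negative parts. -/

section Generalities

/-! Adjoin the unit of `A` to `A_i` to get a finite dimensional unital subalgebra `B_i`, still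
`Γ_i`-invariant. Let `E_i` be the `τ`-preserving conditional expectation onto `B_i`; it commutes
with the action of `Γ_i`. For `f` positive definite and vanishing at infinity, consider the map `∑
a_s u_s ↦ ∑_{s ∈ Γ_i} f(s) E_i(a_s) u_s`. It is unital and trace preserving because `f(1) = 1`. On
`L²` it is an orthogonal sum of the finite rank operators `f(s) E_i`, whose norms tend to zero,
hence compact. As `i` and the index of `f` grow, it converges to the identity: every `s` eventually
lies in `Γ_i`, `f(s) → 1`, and `E_i → id` in `‖·‖_τ` by density.

The work lies in showing that this map is bounded and completely positive (`nonneg_of_coeff_eq`).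
Compressed to finitely many points of `Γ`, an element `x` becomes the matrix over `A` with entries
`α_g⁻¹(x_{gh⁻¹})`. The map then acts in two steps: the trace preserving expectation onto matrices
that are block diagonal for right cosets of `Γ_i` (`IsTraceExpectation.matrix_nonneg`), and the
Schur product with `f(gh⁻¹)` (`inner_matrixRep_schur_nonneg`). Both preserve positivity. Since this
criterion speaks of elements, not of a map, it applies to finite sums before any extension is known
to exist; a 2×2 matrix trick converts it into the contraction estimate `norm_synth_coeffMap_le`,
which permits the extension to the whole algebra. -/

theorem exists_eq_star_mul_self_of_nonneg {D : Type*} [NonUnitalCStarAlgebra D] [PartialOrder D]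
    [StarOrderedRing D] {a : D} (ha : 0 ≤ a) : ∃ b, a = star b * b :=
  CStarAlgebra.nonneg_iff_eq_star_mul_self.1 ha

theorem exists_negPart_of_isSelfAdjoint {D : Type*} [NonUnitalCStarAlgebra D] [PartialOrder D]
    [StarOrderedRing D] {a : D} (ha : IsSelfAdjoint a) :
    ∃ b, 0 ≤ b ∧ b * a = -(b * b) ∧ (b = 0 → 0 ≤ a) := by
  refine ⟨a⁻, CFC.negPart_nonneg a, ?_, fun h => (CFC.negPart_eq_zero_iff a ha).1 h⟩
  nth_rw 2 [← CFC.posPart_sub_negPart a ha]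
  rw [mul_sub, CFC.negPart_mul_posPart, zero_sub]

theorem inner_self_nonneg_complex {E : Type*} [SeminormedAddCommGroup E] [InnerProductSpace ℂ E]
    (x : E) : 0 ≤ inner ℂ x x := by
  rw [inner_self_eq_norm_sq_to_K, RCLike.ofReal_eq_complex_ofReal, ← Complex.ofReal_pow]
  exact Complex.zero_le_real.2 (sq_nonneg _)

theorem eq_zero_of_mul_mul_self_eq_zero {D : Type*} [NonUnitalCStarAlgebra D] {b : D}
    (hb : IsSelfAdjoint b) (h : b * b * b = 0) : b = 0 := by
  have h2 : b * b = 0 := by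
    rw [← CStarRing.star_mul_self_eq_zero_iff, star_mul, hb.star_eq, ← mul_assoc, h, zero_mul]
  rwa [← CStarRing.star_mul_self_eq_zero_iff, hb.star_eq]

/-- A linear functional on a C*-algebra which is nonnegative on the elements `b* b`, as a positive
linear map. -/
noncomputable def positiveFunctional {C : Type*} [CStarAlgebra C] [PartialOrder C]
    [StarOrderedRing C] (f : C →ₗ[ℂ] ℂ) (hf : ∀ b, 0 ≤ f (star b * b)) : C →ₚ[ℂ] ℂ :=
  PositiveLinearMap.mk₀ f fun x hx => by
    obtain ⟨b, rfl⟩ := exists_eq_star_mul_self_of_nonneg hx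
    exact hf b

end Generalities

/-! ### Testing positivity of matrices over a C*-algebra on vectors. -/

section MatrixRepresentation

variable {C : Type*} [CStarAlgebra C]
  {K : Type*} [NormedAddCommGroup K] [InnerProductSpace ℂ K] [CompleteSpace K]
  (π : C →⋆ₐ[ℂ] (K →L[ℂ] K)) {n : Type*} [Fintype n]

/-- The action of matrices over `C` on `K ⊕ ⋯ ⊕ K` induced by a representation of `C` on `K`. -/
noncomputable def matrixRep (M : CStarMatrix n n C) :
    PiLp 2 (fun _ : n => K) →ₗ[ℂ] PiLp 2 (fun _ : n => K) where
  toFun ξ := WithLp.toLp 2 fun p => ∑ q, π (M p q) (ξ q)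
  map_add' ξ η := by ext p; simp [Finset.sum_add_distrib]
  map_smul' c ξ := by ext p; simp [Finset.smul_sum]

@[simp]
theorem matrixRep_apply (M : CStarMatrix n n C) (ξ : PiLp 2 (fun _ : n => K)) (p : n) :
    matrixRep π M ξ p = ∑ q, π (M p q) (ξ q) := rfl

theorem matrixRep_mul (M N : CStarMatrix n n C) (ξ : PiLp 2 (fun _ : n => K)) :
    matrixRep π (M * N) ξ = matrixRep π M (matrixRep π N ξ) := by
  ext p
  simp only [matrixRep_apply, CStarMatrix.mul_apply, map_sum, map_mul,
    sum_apply, mul_apply_eq_comp]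
  exact Finset.sum_comm

theorem matrixRep_neg (M : CStarMatrix n n C) : matrixRep π (-M) = -matrixRep π M := by
  ext ξ p
  simp

theorem inner_matrixRep_star (M : CStarMatrix n n C) (ξ η : PiLp 2 (fun _ : n => K)) :
    inner ℂ (matrixRep π (star M) ξ) η = inner ℂ ξ (matrixRep π M η) := by
  simp only [PiLp.inner_apply, matrixRep_apply, sum_inner, inner_sum, CStarMatrix.star_apply,
    map_star, ContinuousLinearMap.star_eq_adjoint, ContinuousLinearMap.adjoint_inner_left]
  exact Finset.sum_comm

theorem matrixRep_injective (hπ : Function.Injective π) :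
    Function.Injective (matrixRep π (n := n)) := by
  classical
  intro M N h
  refine CStarMatrix.ext fun p q => hπ ?_
  ext v
  have := congrArg (fun x : PiLp 2 (fun _ : n => K) => x p)
    (LinearMap.congr_fun h (WithLp.toLp 2 (Pi.single q v)))
  simpa [matrixRep_apply, Pi.single_apply, apply_ite] using this

theorem inner_matrixRep_eq (M : CStarMatrix n n C) (ξ η : PiLp 2 (fun _ : n => K)) :
    inner ℂ ξ (matrixRep π M η) = ∑ p, ∑ q, inner ℂ (ξ p) (π (M p q) (η q)) := by
  simp [PiLp.inner_apply, inner_sum]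

variable [PartialOrder C] [StarOrderedRing C]

theorem inner_matrixRep_nonneg {M : CStarMatrix n n C} (hM : 0 ≤ M)
    (ξ : PiLp 2 (fun _ : n => K)) : 0 ≤ inner ℂ ξ (matrixRep π M ξ) := by
  obtain ⟨N, rfl⟩ := exists_eq_star_mul_self_of_nonneg hM
  rw [matrixRep_mul, ← inner_matrixRep_star, star_star]
  exact inner_self_nonneg_complex _

/-- Let `b` be the negative part of `M`. Then `b M b = -b³` has nonnegative quadratic form, while
`b³ ≥ 0`; so `b³ = 0` and `b = 0`. -/
theorem nonneg_of_inner_matrixRep_nonneg (hπ : Function.Injective π) {M : CStarMatrix n n C}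
    (hM : ∀ ξ, 0 ≤ inner ℂ ξ (matrixRep π M ξ)) : 0 ≤ M := by
  have hsym : (matrixRep π M).IsSymmetric := by
    rw [LinearMap.isSymmetric_iff_inner_map_self_real]
    intro ξ
    have := (hM ξ).star_eq
    rw [inner_conj_symm, ← this, Complex.star_def, inner_conj_symm]
  have hsa : IsSelfAdjoint M := by
    refine matrixRep_injective π hπ (LinearMap.ext fun ξ => ext_inner_right ℂ fun η => ?_)
    rw [inner_matrixRep_star, hsym]
  obtain ⟨b, hb0, hbM, hM0⟩ := exists_negPart_of_isSelfAdjoint hsa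
  refine hM0 ?_
  have hb : IsSelfAdjoint b := hb0.isSelfAdjoint
  refine eq_zero_of_mul_mul_self_eq_zero hb ?_
  have h4 : 0 ≤ b * b * b := by
    simpa [hb.star_eq] using star_left_conjugate_nonneg hb0 b
  refine matrixRep_injective π hπ ?_
  have h0 : matrixRep π (0 : CStarMatrix n n C) = 0 := by ext ξ p; simp
  rw [h0, ← inner_map_self_eq_zero]
  intro ξ
  rw [← inner_conj_symm, map_eq_zero]
  refine le_antisymm ?_ (inner_matrixRep_nonneg π h4 ξ)
  have h5 : 0 ≤ inner ℂ ξ (matrixRep π (b * M * b) ξ) := by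
    rw [matrixRep_mul, matrixRep_mul, ← inner_matrixRep_star, hb.star_eq]
    exact hM _
  rw [hbM, neg_mul, matrixRep_neg] at h5
  simpa using h5

end MatrixRepresentation

/-! ### Trace preserving conditional expectations. -/

section Trace

/-- Here `y` is the `T`-orthogonal projection of `x` to `S`. Faithfulness makes `y` self-adjoint,
and its negative part stays in the closed algebra `S`, so it may be used as a test element:
`-T((y⁻)²) = T(y⁻ y) = T(y⁻ x) ≥ 0` forces `y⁻ = 0`. It serves both for `B` in `A` and for block
diagonal matrices. -/
theorem nonneg_of_faithful_trace {C : Type*} [CStarAlgebra C] [PartialOrder C] [StarOrderedRing C]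
    (T : C →ₗ[ℂ] ℂ) (hT : ∀ a, 0 ≤ T (star a * a)) (hfaith : ∀ a, T (star a * a) = 0 → a = 0)
    (hcomm : ∀ a b, T (a * b) = T (b * a)) (hstar : ∀ a, T (star a) = star (T a))
    (S : StarSubalgebra ℂ C) (hS : IsClosed (S : Set C)) {x y : C} (hx : 0 ≤ x) (hy : y ∈ S)
    (hxy : ∀ c ∈ S, T (c * y) = T (c * x)) : 0 ≤ y := by
  have hsa : IsSelfAdjoint y := by
    have h1 : ∀ c ∈ S, T (c * star y) = T (c * y) := fun c hc => by
      have : T (c * star y) = star (T (star c * y)) := by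
        rw [← hstar, star_mul, star_star, hcomm]
      rw [this, hxy _ (star_mem hc), ← hstar, star_mul, star_star, hx.isSelfAdjoint.star_eq, hcomm,
        hxy c hc]
    have h2 : star y - y = 0 := by
      refine hfaith _ ?_
      rw [mul_sub, map_sub, h1 _ (star_mem (sub_mem (star_mem hy) hy)), sub_self]
    exact sub_eq_zero.1 h2
  rw [← CFC.negPart_eq_zero_iff y hsa]
  have hb0 := CFC.negPart_nonneg y
  have hb : IsSelfAdjoint y⁻ := hb0.isSelfAdjoint
  have hbS : y⁻ ∈ S := cfcₙ_mem (hs := hS) _ hy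
  refine hfaith _ ?_
  refine le_antisymm ?_ (hT _)
  -- With `x = d*d` and `y⁻ = e*e`, traciality gives `T(y⁻ x) = T((de*)*(de*))`.
  have h1 : 0 ≤ T (y⁻ * x) := by
    obtain ⟨d, rfl⟩ := CStarAlgebra.nonneg_iff_eq_star_mul_self.1 hx
    obtain ⟨e, he⟩ := CStarAlgebra.nonneg_iff_eq_star_mul_self.1 hb0
    rw [he, mul_assoc, hcomm, mul_assoc, mul_assoc, ← mul_assoc, ← mul_assoc, mul_assoc]
    have := hT (d * star e)
    rwa [star_mul, star_star] at this
  rw [← hxy _ hbS] at h1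
  have h2 : y⁻ * y = -(star y⁻ * y⁻) := by
    nth_rw 2 [← CFC.posPart_sub_negPart y hsa]
    rw [mul_sub, CFC.negPart_mul_posPart, zero_sub, hb.star_eq]
  rw [h2, map_neg] at h1
  simpa using h1

end Trace

section Action

variable {A : Type*} [CStarAlgebra A] {Γ : Type*} [Group Γ] (α : Γ →* (A ≃⋆ₐ[ℂ] A))

theorem action_mul_apply (g h : Γ) (a : A) : α (g * h) a = α g (α h a) := by
  rw [map_mul]; rfl

theorem action_inv_apply_apply (g : Γ) (a : A) : α g⁻¹ (α g a) = a := by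
  rw [← action_mul_apply, inv_mul_cancel, map_one]; rfl

theorem action_apply_inv_apply (g : Γ) (a : A) : α g (α g⁻¹ a) = a := by
  rw [← action_mul_apply, mul_inv_cancel, map_one]; rfl

theorem action_symm_apply (g : Γ) (a : A) : (α g).symm a = α g⁻¹ a := by
  rw [map_inv]; rfl

end Action

section Expectation

variable {A : Type*} [CStarAlgebra A] [PartialOrder A] [StarOrderedRing A] {τ : A →ₚ[ℂ] ℂ}

/-- `E` is the `τ`-preserving conditional expectation of `A` onto the subalgebra `B`. -/
structure IsTraceExpectation (τ : A →ₚ[ℂ] ℂ) (B : StarSubalgebra ℂ A) (E : A →ₗ[ℂ] A) : Prop where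
  mem : ∀ a, E a ∈ B
  trace_mul : ∀ c ∈ B, ∀ a, τ (c * E a) = τ (c * a)

/-- Faithfulness makes `b ↦ τ(· b)` injective from `B` to its dual, hence bijective by dimension. `E
a` is the element of `B` representing the functional `τ(· a)`. -/
theorem exists_isTraceExpectation (hτ : IsFaithfulTracialState τ) (B : StarSubalgebra ℂ A)
    [FiniteDimensional ℂ B] : ∃ E : A →ₗ[ℂ] A, IsTraceExpectation τ B E := by
  let L : A →ₗ[ℂ] Module.Dual ℂ B :=
    LinearMap.mk₂ ℂ (fun (a : A) (c : B) => τ (c * a))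
      (by intros; simp [mul_add]) (by intros; simp)
      (by intros; simp [add_mul]) (by intros; simp) 
  have hL (a : A) (c : B) : L a c = τ (c * a) := rfl
  let LB : B →ₗ[ℂ] Module.Dual ℂ B := L ∘ₗ B.toSubalgebra.toSubmodule.subtype
  have hLB (b c : B) : LB b c = τ (c * b) := rfl
  have hinj : Function.Injective LB := by
    rw [← LinearMap.ker_eq_bot, LinearMap.ker_eq_bot']
    intro b hb
    have := LinearMap.congr_fun hb (star b)
    rw [hLB] at this
    exact Subtype.ext (hτ.faithful _ this)
  let e := LinearMap.linearEquivOfInjective LB hinj Subspace.dual_finrank_eq.symm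
  have he (f : Module.Dual ℂ B) : LB (e.symm f) = f :=
    e.apply_symm_apply f
  refine ⟨B.toSubalgebra.toSubmodule.subtype ∘ₗ e.symm.toLinearMap ∘ₗ L, fun a => ?_,
    fun c hc a => ?_⟩
  · exact (e.symm (L a)).2
  · exact (hLB _ ⟨c, hc⟩).symm.trans (LinearMap.congr_fun (he (L a)) _)

namespace IsTraceExpectation

variable {B : StarSubalgebra ℂ A} {E : A →ₗ[ℂ] A}

/-- This uniqueness is the source of the algebraic properties of `E` below. -/
theorem eq_of_trace_mul (hτ : IsFaithfulTracialState τ) (hE : IsTraceExpectation τ B E) {y a : A}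
    (hy : y ∈ B) (h : ∀ c ∈ B, τ (c * y) = τ (c * a)) : E a = y := by
  rw [← sub_eq_zero]
  refine hτ.faithful _ ?_
  have hc := star_mem (sub_mem (hE.mem a) hy)
  rw [mul_sub, map_sub, hE.trace_mul _ hc, h _ hc, sub_self]

theorem trace_apply (hE : IsTraceExpectation τ B E) (a : A) : τ (E a) = τ a := by
  simpa using hE.trace_mul 1 (one_mem B) a

theorem apply_of_mem (hτ : IsFaithfulTracialState τ) (hE : IsTraceExpectation τ B E) {b : A}
    (hb : b ∈ B) : E b = b :=
  hE.eq_of_trace_mul hτ hb fun _ _ => rfl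

theorem map_star_apply (hτ : IsFaithfulTracialState τ) (hE : IsTraceExpectation τ B E) (a : A) :
    E (star a) = star (E a) := by
  refine hE.eq_of_trace_mul hτ (star_mem (hE.mem a)) fun c hc => ?_
  rw [hτ.map_mul_comm, hτ.map_mul_comm c, ← star_star c, ← star_mul, ← star_mul, map_star, map_star,
    hE.trace_mul _ (star_mem hc)]

/-- `E` is determined by `τ` and `B`, so it commutes with any automorphism that preserves both. -/
theorem comm (hτ : IsFaithfulTracialState τ) (hE : IsTraceExpectation τ B E)
    (σ : A ≃⋆ₐ[ℂ] A) (hσ : ∀ a, τ (σ a) = τ a) (hB : ∀ b ∈ B, σ b ∈ B)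
    (hB' : ∀ b ∈ B, σ.symm b ∈ B) (a : A) : E (σ a) = σ (E a) := by
  refine hE.eq_of_trace_mul hτ (hB _ (hE.mem a)) fun c hc => ?_
  have h (x : A) : τ (c * σ x) = τ (σ.symm c * x) := by
    rw [← hσ (σ.symm c * x), map_mul σ, StarAlgEquiv.apply_symm_apply]
  rw [h, h, hE.trace_mul _ (hB' c hc)]

theorem map_nonneg (hτ : IsFaithfulTracialState τ) (hE : IsTraceExpectation τ B E)
    (hB : IsClosed (B : Set A)) {a : A} (ha : 0 ≤ a) : 0 ≤ E a :=
  nonneg_of_faithful_trace (τ : A →ₗ[ℂ] ℂ) (fun a => τ.map_nonneg (star_mul_self_nonneg a))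
    hτ.faithful hτ.map_mul_comm (fun a => map_star τ a) B hB ha (hE.mem a)
    (fun c hc => hE.trace_mul c hc a)

theorem continuous (hτ : IsFaithfulTracialState τ) (hE : IsTraceExpectation τ B E)
    (hB : IsClosed (B : Set A)) : Continuous E :=
  map_continuous (PositiveLinearMap.mk₀ E fun _ ha => hE.map_nonneg hτ hB ha)

/-- `E` is the orthogonal projection onto `B` in `L²`: `⟨Ea, Ea⟩ = ⟨Ea, a⟩`, then Cauchy–Schwarz. -/
theorem norm_toPreGNS_apply_le (hE : IsTraceExpectation τ B E) (a : A) :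
    ‖τ.toPreGNS (E a)‖ ≤ ‖τ.toPreGNS a‖ := by
  have h1 : inner ℂ (τ.toPreGNS (E a)) (τ.toPreGNS (E a)) =
      inner ℂ (τ.toPreGNS (E a)) (τ.toPreGNS a) :=
    hE.trace_mul _ (star_mem (hE.mem a)) a
  have h2 : ‖τ.toPreGNS (E a)‖ * ‖τ.toPreGNS (E a)‖ ≤ ‖τ.toPreGNS (E a)‖ * ‖τ.toPreGNS a‖ := by
    rw [← inner_self_eq_norm_mul_norm (𝕜 := ℂ), h1]
    exact (RCLike.re_le_norm _).trans (norm_inner_le_norm _ _)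
  rcases (norm_nonneg (τ.toPreGNS (E a))).eq_or_lt with h | h
  · rw [← h]; exact norm_nonneg _
  · exact le_of_mul_le_mul_left h2 h

theorem norm_toPreGNS_apply_sub_le (hτ : IsFaithfulTracialState τ) (hE : IsTraceExpectation τ B E)
    (a : A) {b : A} (hb : b ∈ B) :
    ‖τ.toPreGNS (E a - a)‖ ≤ 2 * ‖τ.toPreGNS (a - b)‖ := by
  have h : E a - a = E (a - b) - (a - b) := by
    rw [map_sub, hE.apply_of_mem hτ hb]; abel
  rw [h, map_sub, two_mul]
  exact (norm_sub_le _ _).trans (add_le_add_left (hE.norm_toPreGNS_apply_le _) _)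

end IsTraceExpectation

section Action

variable {Γ : Type*} [Group Γ] (α : Γ →* (A ≃⋆ₐ[ℂ] A))

variable {ι : Type*} [Fintype ι] [DecidableEq ι]

/-- The matrices over `A`, indexed by a family `γ` of group elements, which are block diagonal for
the right cosets of `G`, with entries in the translates of `B`. -/
def blockSubalgebra (G : Subgroup Γ) (B : StarSubalgebra ℂ A)
    (hB : ∀ g ∈ G, ∀ b ∈ B, α g b ∈ B) (γ : ι → Γ) : StarSubalgebra ℂ (CStarMatrix ι ι A) where
  carrier := {z | ∀ p q, (γ p * (γ q)⁻¹ ∈ G → α (γ p) (z p q) ∈ B) ∧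
    (γ p * (γ q)⁻¹ ∉ G → z p q = 0)}
  mul_mem' {x y} hx hy p q := by
    refine ⟨fun h => ?_, fun h => ?_⟩
    · rw [CStarMatrix.mul_apply, map_sum]
      refine sum_mem fun r _ => ?_
      by_cases hr : γ p * (γ r)⁻¹ ∈ G
      · have hr' : γ r * (γ q)⁻¹ ∈ G := by
          simpa [mul_assoc] using G.mul_mem (G.inv_mem hr) h
        rw [map_mul]
        refine mul_mem ((hx p r).1 hr) ?_
        -- Within a coset, `α (γ p)` differs from `α (γ r)` by an element of `G`, which preserves
        -- `B`.
        have := hB _ hr _ ((hy r q).1 hr')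
        rwa [← action_mul_apply, inv_mul_cancel_right] at this
      · simp [(hx p r).2 hr]
    · rw [CStarMatrix.mul_apply]
      refine Finset.sum_eq_zero fun r _ => ?_
      by_cases hr : γ p * (γ r)⁻¹ ∈ G
      · rw [(hy r q).2 fun hr' => h ?_, mul_zero]
        simpa [mul_assoc] using G.mul_mem hr hr'
      · rw [(hx p r).2 hr, zero_mul]
  add_mem' {x y} hx hy p q := by
    refine ⟨fun h => ?_, fun h => ?_⟩
    · rw [CStarMatrix.add_apply, map_add]
      exact add_mem ((hx p q).1 h) ((hy p q).1 h)
    · rw [CStarMatrix.add_apply, (hx p q).2 h, (hy p q).2 h, add_zero]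
  algebraMap_mem' c p q := by
    rw [Algebra.algebraMap_eq_smul_one, CStarMatrix.smul_apply]
    rcases eq_or_ne p q with rfl | hpq
    · refine ⟨fun _ => ?_, fun h => (h (by simp)).elim⟩
      rw [CStarMatrix.one_apply_eq, map_smul, map_one]
      exact B.smul_mem (one_mem B) c
    · rw [CStarMatrix.one_apply_ne hpq]
      simp
  star_mem' {x} hx p q := by
    rw [CStarMatrix.star_apply]
    have key : γ p * (γ q)⁻¹ ∈ G ↔ γ q * (γ p)⁻¹ ∈ G := by
      rw [← G.inv_mem_iff]; simp
    refine ⟨fun h => ?_, fun h => ?_⟩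
    · have := hB _ h _ ((hx q p).1 (key.1 h))
      rw [← action_mul_apply, inv_mul_cancel_right] at this
      rw [map_star]
      exact star_mem this
    · rw [(hx q p).2 (fun h' => h (key.2 h')), star_zero]

theorem isClosed_blockSubalgebra (G : Subgroup Γ) {B : StarSubalgebra ℂ A}
    (hB : ∀ g ∈ G, ∀ b ∈ B, α g b ∈ B) (hBc : IsClosed (B : Set A)) (γ : ι → Γ) :
    IsClosed (blockSubalgebra α G B hB γ : Set (CStarMatrix ι ι A)) := by
  have hset : (blockSubalgebra α G B hB γ : Set (CStarMatrix ι ι A)) =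
      ⋂ p, ⋂ q, {z | (γ p * (γ q)⁻¹ ∈ G → α (γ p) (z p q) ∈ B) ∧
        (γ p * (γ q)⁻¹ ∉ G → z p q = 0)} := by
    ext z
    simp only [Set.mem_iInter]
    rfl
  rw [hset]
  refine isClosed_iInter fun p => isClosed_iInter fun q => ?_
  have hcont : Continuous fun z : CStarMatrix ι ι A => z p q :=
    (continuous_apply q).comp (continuous_apply (A := fun _ => ι → A) p)
  have hα : Continuous (α (γ p)) := map_continuous (α (γ p))
  by_cases h : γ p * (γ q)⁻¹ ∈ G
  · simpa only [h, not_true_eq_false, false_imp_iff, true_imp_iff, and_true] using!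
      hBc.preimage (hα.comp hcont)
  · simpa only [h, not_false_eq_true, false_imp_iff, true_imp_iff, true_and] using!
      isClosed_singleton.preimage hcont

/-- The sum of the values of `τ` on the diagonal entries of a matrix over `A`. -/
noncomputable def matrixTrace (τ : A →ₚ[ℂ] ℂ) : CStarMatrix ι ι A →ₗ[ℂ] ℂ where
  toFun z := ∑ p, τ (z p p)
  map_add' x y := by simp [Finset.sum_add_distrib]
  map_smul' c x := by simp [Finset.mul_sum]

theorem matrixTrace_mul (x y : CStarMatrix ι ι A) :
    matrixTrace τ (x * y) = ∑ p, ∑ q, τ (x p q * y q p) := by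
  simp [matrixTrace, CStarMatrix.mul_apply]

-- The new matrix is the expectation of `x`, for the matrix trace, onto `blockSubalgebra`: the map
-- `α_g⁻¹ E α_g` is the expectation onto `α_g⁻¹(B)`, which depends only on the right coset of `g`
-- because `B` is `G`-invariant.
open Classical in
theorem IsTraceExpectation.matrix_nonneg (hτ : IsFaithfulTracialState τ)
    (hinv : ∀ g a, τ (α g a) = τ a) {G : Subgroup Γ} {B : StarSubalgebra ℂ A} {E : A →ₗ[ℂ] A}
    (hE : IsTraceExpectation τ B E) (hBc : IsClosed (B : Set A))
    (hB : ∀ g ∈ G, ∀ b ∈ B, α g b ∈ B) (γ : ι → Γ) {x : CStarMatrix ι ι A} (hx : 0 ≤ x) :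
    0 ≤ CStarMatrix.ofMatrix (fun p q =>
      if γ p * (γ q)⁻¹ ∈ G then α (γ p)⁻¹ (E (α (γ p) (x p q))) else 0) := by
  refine nonneg_of_faithful_trace (matrixTrace τ) (fun a => ?_) (fun a ha => ?_) (fun a b => ?_)
    (fun a => ?_) (blockSubalgebra α G B hB γ) (isClosed_blockSubalgebra α G hB hBc γ) hx
    (fun p q => ?_) fun c hc => ?_
  · rw [matrixTrace_mul]
    exact Finset.sum_nonneg fun p _ => Finset.sum_nonneg fun q _ =>
      τ.map_nonneg (star_mul_self_nonneg (a q p))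
  · have hnn : ∀ p q, 0 ≤ τ (star (a q p) * a q p) := fun p q =>
      τ.map_nonneg (star_mul_self_nonneg (a q p))
    rw [matrixTrace_mul] at ha
    refine CStarMatrix.ext fun q p => hτ.faithful _ ?_
    have h1 := (Finset.sum_eq_zero_iff_of_nonneg fun p _ =>
      Finset.sum_nonneg fun q _ => hnn p q).1 ha p (Finset.mem_univ _)
    exact (Finset.sum_eq_zero_iff_of_nonneg fun q _ => hnn p q).1 h1 q (Finset.mem_univ _)
  · rw [matrixTrace_mul, matrixTrace_mul, Finset.sum_comm]
    simp_rw [hτ.map_mul_comm (a _ _)]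
  · change ∑ p, τ (star (a p p)) = star (∑ p, τ (a p p))
    simp_rw [map_star τ, star_sum]
  · refine ⟨fun h => ?_, fun h => if_neg h⟩
    change α (γ p) (if γ p * (γ q)⁻¹ ∈ G then α (γ p)⁻¹ (E (α (γ p) (x p q))) else 0) ∈ B
    rw [if_pos h, action_apply_inv_apply]
    exact hE.mem _
  -- The trace identity holds entry by entry: outside the blocks `c` vanishes, and inside them
  -- invariance of `τ` under `α (γ q)` reduces it to the defining property of `E`.
  · rw [matrixTrace_mul, matrixTrace_mul]
    refine Finset.sum_congr rfl fun p _ => Finset.sum_congr rfl fun q _ => ?_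
    change τ (c p q * if γ q * (γ p)⁻¹ ∈ G then α (γ q)⁻¹ (E (α (γ q) (x q p))) else 0) = _
    have key : γ q * (γ p)⁻¹ ∈ G ↔ γ p * (γ q)⁻¹ ∈ G := by
      rw [← G.inv_mem_iff]; simp
    by_cases h : γ q * (γ p)⁻¹ ∈ G
    · have hcB : α (γ q) (c p q) ∈ B := by
        have := hB _ h _ ((hc p q).1 (key.1 h))
        rwa [← action_mul_apply, inv_mul_cancel_right] at this
      rw [if_pos h, ← hinv (γ q), map_mul, action_apply_inv_apply, hE.trace_mul _ hcB, ← map_mul,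
        hinv]
    · rw [if_neg h, (hc p q).2 fun h' => h (key.2 h'), zero_mul, zero_mul]

end Action

end Expectation

/-! ### Adjoining the unit to a finite dimensional subalgebra. -/

section Unitization

variable {A : Type*} [CStarAlgebra A]

/-- The generated unital algebra is the image of the unitization `ℂ ⊕ S`. -/
theorem finiteDimensional_adjoin (S : NonUnitalStarSubalgebra ℂ A) [FiniteDimensional ℂ S] :
    FiniteDimensional ℂ (StarAlgebra.adjoin ℂ (S : Set A)) := by
  have : FiniteDimensional ℂ (Unitization ℂ S) :=
    Module.Finite.equiv (Unitization.linearEquiv ℂ ℂ S).symm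
  rw [← NonUnitalStarSubalgebra.unitization_range S]
  exact inferInstanceAs (FiniteDimensional ℂ
    (LinearMap.range (NonUnitalStarSubalgebra.unitization S).toAlgHom.toLinearMap))

theorem apply_mem_adjoin (σ : A ≃⋆ₐ[ℂ] A) {S : NonUnitalStarSubalgebra ℂ A}
    (hS : ∀ a ∈ S, σ a ∈ S) {b : A} (hb : b ∈ StarAlgebra.adjoin ℂ (S : Set A)) :
    σ b ∈ StarAlgebra.adjoin ℂ (S : Set A) := by
  induction hb using StarAlgebra.adjoin_induction with
  | mem x hx => exact StarAlgebra.subset_adjoin ℂ _ (hS x hx)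
  | algebraMap r =>
    rw [Algebra.algebraMap_eq_smul_one, map_smul, map_one]
    exact StarSubalgebra.smul_mem _ (one_mem _) r
  | add x y _ _ hx hy => rw [map_add]; exact add_mem hx hy
  | mul x y _ _ hx hy => rw [map_mul]; exact mul_mem hx hy
  | star x _ hx => rw [map_star]; exact star_mem hx

theorem isClosed_of_finiteDimensional (B : StarSubalgebra ℂ A) [FiniteDimensional ℂ B] :
    IsClosed (B : Set A) := by
  have : FiniteDimensional ℂ B.toSubalgebra.toSubmodule := ‹FiniteDimensional ℂ B›
  exact B.toSubalgebra.toSubmodule.closed_of_finiteDimensional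

end Unitization

/-! ### Finite sums and Fourier coefficients in the reduced crossed product. -/

namespace ReducedCrossedProduct

variable {Γ : Type*} [Group Γ] {A : Type*} [CStarAlgebra A]
  {H : Type*} [NormedAddCommGroup H] [InnerProductSpace ℂ H] [CompleteSpace H]
  (α : Γ →* (A ≃⋆ₐ[ℂ] A)) (π : A →⋆ₐ[ℂ] (H →L[ℂ] H))

theorem continuous_eval (g : Γ) : Continuous fun ξ : L2Group Γ H => ξ g :=
  (LinearMap.mkContinuous
    ({ toFun := fun ξ => ξ g
       map_add' := fun _ _ => rfl
       map_smul' := fun _ _ => rfl } : L2Group Γ H →ₗ[ℂ] H) 1 fun ξ => by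
    rw [one_mul]; exact lp.norm_apply_le_norm two_ne_zero ξ g).continuous

/-- The defining representation of the reduced crossed product on `ℓ²(Γ, H)`. -/
noncomputable def incl : ReducedCrossedProduct α π →⋆ₐ[ℂ] (L2Group Γ H →L[ℂ] L2Group Γ H) :=
  (reducedCrossedProductSubalgebra α π).subtype

theorem incl_injective : Function.Injective (incl α π) := Subtype.val_injective

theorem norm_incl (x : ReducedCrossedProduct α π) : ‖incl α π x‖ = ‖x‖ := rfl

theorem continuous_incl : Continuous (incl α π) := continuous_subtype_val

theorem incl_ofAlg_apply (a : A) (ξ : L2Group Γ H) (g : Γ) :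
    incl α π (ofAlg α π a) ξ g = π (α g⁻¹ a) (ξ g) := rfl

theorem incl_ofGroup_apply (s : Γ) (ξ : L2Group Γ H) (g : Γ) :
    incl α π (ofGroup α π s) ξ g = ξ (s⁻¹ * g) := rfl

variable {α π}

theorem ext_apply {x y : ReducedCrossedProduct α π}
    (h : ∀ ξ g, incl α π x ξ g = incl α π y ξ g) : x = y :=
  incl_injective α π (ContinuousLinearMap.ext fun ξ => lp.ext (funext (h ξ)))

variable (α π)

theorem ofGroup_one : ofGroup α π 1 = 1 := by
  refine ext_apply fun ξ g => ?_
  rw [incl_ofGroup_apply, map_one, inv_one, one_mul]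
  rfl

theorem ofGroup_mul (s t : Γ) : ofGroup α π (s * t) = ofGroup α π s * ofGroup α π t := by
  refine ext_apply fun ξ g => ?_
  rw [map_mul, mul_apply_eq_comp]
  simp only [incl_ofGroup_apply, mul_inv_rev, mul_assoc]

theorem ofAlg_one : ofAlg α π 1 = 1 := by
  refine ext_apply fun ξ g => ?_
  rw [incl_ofAlg_apply, map_one, map_one, map_one]
  rfl

theorem ofAlg_add (a b : A) : ofAlg α π (a + b) = ofAlg α π a + ofAlg α π b := by
  refine ext_apply fun ξ g => ?_
  rw [map_add, add_apply, lp.coeFn_add, Pi.add_apply]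
  simp only [incl_ofAlg_apply, map_add, add_apply]

theorem ofAlg_smul (z : ℂ) (a : A) : ofAlg α π (z • a) = z • ofAlg α π a := by
  refine ext_apply fun ξ g => ?_
  rw [map_smul, smul_apply, lp.coeFn_smul, Pi.smul_apply]
  simp only [incl_ofAlg_apply, map_smul, smul_apply]

theorem ofAlg_mul (a b : A) : ofAlg α π (a * b) = ofAlg α π a * ofAlg α π b := by
  refine ext_apply fun ξ g => ?_
  rw [map_mul, mul_apply_eq_comp]
  simp only [incl_ofAlg_apply, map_mul, mul_apply_eq_comp]

theorem ofGroup_mul_ofAlg (s : Γ) (a : A) :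
    ofGroup α π s * ofAlg α π a = ofAlg α π (α s a) * ofGroup α π s := by
  refine ext_apply fun ξ g => ?_
  rw [map_mul, map_mul, mul_apply_eq_comp, mul_apply_eq_comp]
  simp only [incl_ofAlg_apply, incl_ofGroup_apply, mul_inv_rev, inv_inv, action_mul_apply]

theorem star_ofAlg (a : A) : star (ofAlg α π a) = ofAlg α π (star a) := by
  refine incl_injective α π ?_
  rw [map_star, ContinuousLinearMap.star_eq_adjoint, eq_comm, ContinuousLinearMap.eq_adjoint_iff]
  intro ξ η
  rw [lp.inner_eq_tsum, lp.inner_eq_tsum]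
  refine tsum_congr fun g => ?_
  rw [incl_ofAlg_apply, incl_ofAlg_apply, map_star, map_star, ContinuousLinearMap.star_eq_adjoint,
    ContinuousLinearMap.adjoint_inner_left]

theorem star_ofGroup (s : Γ) : star (ofGroup α π s) = ofGroup α π s⁻¹ := by
  refine incl_injective α π ?_
  rw [map_star, ContinuousLinearMap.star_eq_adjoint, eq_comm, ContinuousLinearMap.eq_adjoint_iff]
  intro ξ η
  rw [lp.inner_eq_tsum, lp.inner_eq_tsum, ← (Equiv.mulLeft s⁻¹).tsum_eq]
  refine tsum_congr fun g => ?_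
  rw [incl_ofGroup_apply, incl_ofGroup_apply]
  simp

/-- The finite sum `∑ a_s u_s` in the reduced crossed product. -/
noncomputable def synth : (Γ →₀ A) →ₗ[ℂ] ReducedCrossedProduct α π :=
  Finsupp.lsum ℂ fun s =>
    { toFun := fun a => ofAlg α π a * ofGroup α π s
      map_add' := fun a b => by rw [ofAlg_add, add_mul]
      map_smul' := fun z a => by rw [ofAlg_smul, smul_mul_assoc, RingHom.id_apply] }

theorem synth_single (s : Γ) (a : A) :
    synth α π (Finsupp.single s a) = ofAlg α π a * ofGroup α π s := by
  rw [synth, Finsupp.lsum_single]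
  rfl

theorem synth_single_mul (s t : Γ) (a b : A) :
    synth α π (Finsupp.single s a) * synth α π (Finsupp.single t b) =
      synth α π (Finsupp.single (s * t) (a * α s b)) := by
  simp only [synth_single, ofGroup_mul, ofAlg_mul]
  rw [mul_assoc, ← mul_assoc (ofGroup α π s), ofGroup_mul_ofAlg]
  simp only [mul_assoc]

theorem star_synth_single (s : Γ) (a : A) :
    star (synth α π (Finsupp.single s a)) =
      synth α π (Finsupp.single s⁻¹ (α s⁻¹ (star a))) := by
  rw [synth_single, synth_single, star_mul, star_ofAlg, star_ofGroup, ofGroup_mul_ofAlg]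

theorem mul_mem_range_synth {x y : ReducedCrossedProduct α π}
    (hx : x ∈ LinearMap.range (synth α π)) (hy : y ∈ LinearMap.range (synth α π)) :
    x * y ∈ LinearMap.range (synth α π) := by
  obtain ⟨c, rfl⟩ := hx
  obtain ⟨d, rfl⟩ := hy
  induction c using Finsupp.induction_linear with
  | zero => simp
  | add c c' hc hc' => rw [map_add, add_mul]; exact add_mem hc hc'
  | single s a =>
    induction d using Finsupp.induction_linear with
    | zero => simp
    | add d d' hd hd' => rw [map_add, mul_add]; exact add_mem hd hd'
    | single t b => exact ⟨_, (synth_single_mul α π s t a b).symm⟩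

theorem star_mem_range_synth {x : ReducedCrossedProduct α π}
    (hx : x ∈ LinearMap.range (synth α π)) : star x ∈ LinearMap.range (synth α π) := by
  obtain ⟨c, rfl⟩ := hx
  induction c using Finsupp.induction_linear with
  | zero => simp
  | add c c' hc hc' => rw [map_add, star_add]; exact add_mem hc hc'
  | single s a => exact ⟨_, (star_synth_single α π s a).symm⟩

theorem one_eq_synth : (1 : ReducedCrossedProduct α π) = synth α π (Finsupp.single 1 1) := by
  rw [synth_single, ofAlg_one, ofGroup_one, one_mul]

/-- By the covariance relation the finite sums form a *-algebra; it contains the generators, so it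
is all of the algebra they generate. -/
theorem denseRange_synth : DenseRange (synth α π) := by
  have h : ∀ T ∈ StarAlgebra.adjoin ℂ
      (Set.range (regularRepAlg α π) ∪ Set.range (regularRepGroup (Γ := Γ) H)),
      ∃ x ∈ LinearMap.range (synth α π), incl α π x = T := by
    intro T hT
    induction hT using StarAlgebra.adjoin_induction with
    | mem T hT =>
      rcases hT with ⟨a, rfl⟩ | ⟨s, rfl⟩
      · refine ⟨ofAlg α π a, ⟨Finsupp.single 1 a, ?_⟩, rfl⟩
        rw [synth_single, ofGroup_one, mul_one]
      · refine ⟨ofGroup α π s, ⟨Finsupp.single s 1, ?_⟩, rfl⟩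
        rw [synth_single, ofAlg_one, one_mul]
    | algebraMap r =>
      refine ⟨r • 1, Submodule.smul_mem _ _ ⟨_, (one_eq_synth α π).symm⟩, ?_⟩
      rw [map_smul, map_one, Algebra.algebraMap_eq_smul_one]
    | add S T _ _ hS hT =>
      obtain ⟨x, hx, rfl⟩ := hS
      obtain ⟨y, hy, rfl⟩ := hT
      exact ⟨x + y, add_mem hx hy, map_add _ _ _⟩
    | mul S T _ _ hS hT =>
      obtain ⟨x, hx, rfl⟩ := hS
      obtain ⟨y, hy, rfl⟩ := hT
      exact ⟨x * y, mul_mem_range_synth α π hx hy, map_mul _ _ _⟩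
    | star T _ hT =>
      obtain ⟨x, hx, rfl⟩ := hT
      exact ⟨star x, star_mem_range_synth α π hx, map_star _ _⟩
  intro x
  have hind : Topology.IsInducing (incl α π) := Topology.IsInducing.subtypeVal
  rw [hind.closure_eq_preimage_closure_image]
  refine closure_mono (fun T hT => ?_) x.2
  obtain ⟨y, ⟨c, rfl⟩, hy⟩ := h T hT
  exact ⟨_, ⟨c, rfl⟩, hy⟩

-- Since `u_s` moves the point `h` to `sh`, the operator entry at `(g, h)` sees only the coefficient
-- at `gh⁻¹`.
open Classical in
theorem incl_synth_single (c : Γ →₀ A) (h : Γ) (v : H) (g : Γ) :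
    incl α π (synth α π c) (lp.single 2 h v) g = π (α g⁻¹ (c (g * h⁻¹))) v := by
  induction c using Finsupp.induction_linear with
  | zero => simp
  | add c d hc hd =>
    rw [map_add, map_add, add_apply, lp.coeFn_add, Pi.add_apply, hc, hd, Finsupp.add_apply, map_add,
      map_add, add_apply]
  | single s a =>
    rw [synth_single, map_mul, mul_apply_eq_comp, incl_ofAlg_apply, incl_ofGroup_apply]
    rcases eq_or_ne s (g * h⁻¹) with rfl | hs
    · simp
    · rw [lp.single_apply_ne, Finsupp.single_eq_of_ne' hs]
      · simp
      · intro h'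
        exact hs (by rw [← h']; simp)

section Coefficients

/-- The coefficient at `s` is the operator entry at `(1, s⁻¹)`, where the twist by `α` is trivial.
-/
theorem norm_le_norm_synth (hπ : Function.Injective π) (s : Γ) (c : Γ →₀ A) :
    ‖c s‖ ≤ ‖synth α π c‖ := by
  classical
  rw [← NonUnitalStarAlgHom.norm_map π hπ, ← norm_incl]
  refine ContinuousLinearMap.opNorm_le_bound _ (norm_nonneg _) fun v => ?_
  have h := incl_synth_single α π c s⁻¹ v 1
  rw [inv_inv, one_mul, inv_one, map_one] at h
  have h' : π (c s) v = incl α π (synth α π c) (lp.single 2 s⁻¹ v) 1 := h.symm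
  rw [h']
  refine (lp.norm_apply_le_norm two_ne_zero _ _).trans ?_
  refine (ContinuousLinearMap.le_opNorm _ _).trans_eq ?_
  rw [lp.norm_single (by norm_num)]

/-- The Fourier coefficient `a_s` of an element `∑ a_s u_s` of the reduced crossed product. -/
noncomputable def coeff (s : Γ) : ReducedCrossedProduct α π →L[ℂ] A :=
  (Finsupp.lapply s : (Γ →₀ A) →ₗ[ℂ] A).extendOfNorm (synth α π)

variable {α π}

theorem coeff_synth (hπ : Function.Injective π) (s : Γ) (c : Γ →₀ A) :
    coeff α π s (synth α π c) = c s :=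
  LinearMap.extendOfNorm_eq (denseRange_synth α π)
    ⟨1, fun c => by rw [one_mul]; exact norm_le_norm_synth α π hπ s c⟩ c

theorem ext_of_synth {X : Type*} [TopologicalSpace X] [T2Space X]
    {f g : ReducedCrossedProduct α π → X} (hf : Continuous f) (hg : Continuous g)
    (h : ∀ c, f (synth α π c) = g (synth α π c)) (x : ReducedCrossedProduct α π) : f x = g x :=
  congrFun (DenseRange.equalizer (denseRange_synth α π) hf hg (funext h)) x

open Classical in
theorem incl_single_apply (hπ : Function.Injective π) (x : ReducedCrossedProduct α π) (h : Γ)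
    (v : H) (g : Γ) :
    incl α π x (lp.single 2 h v) g = π (α g⁻¹ (coeff α π (g * h⁻¹) x)) v := by
  refine ext_of_synth (f := fun x => incl α π x (lp.single 2 h v) g)
    (g := fun x => π (α g⁻¹ (coeff α π (g * h⁻¹) x)) v) ?_ ?_ (fun c => ?_) x
  · exact (continuous_eval g).comp ((continuous_incl α π).clm_apply continuous_const)
  · exact ((map_continuous π).comp ((map_continuous (α g⁻¹)).comp
      (coeff α π (g * h⁻¹)).continuous)).clm_apply continuous_const
  · rw [coeff_synth hπ, incl_synth_single]

/-- The coefficients determine all operator entries, and vectors supported at one point span a dense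
subspace. -/
theorem ext_coeff (hπ : Function.Injective π) {x y : ReducedCrossedProduct α π}
    (h : ∀ s, coeff α π s x = coeff α π s y) : x = y := by
  classical
  refine incl_injective α π (ContinuousLinearMap.ext fun ξ => ?_)
  have h1 := (lp.hasSum_single (p := 2) (by norm_num) ξ).mapL (incl α π x)
  have h2 := (lp.hasSum_single (p := 2) (by norm_num) ξ).mapL (incl α π y)
  refine h1.unique (h2.congr_fun ?_)
  intro g
  refine lp.ext (funext fun k => ?_)
  rw [incl_single_apply hπ, incl_single_apply hπ, h]

theorem coeff_star (hπ : Function.Injective π) (s : Γ) (x : ReducedCrossedProduct α π) :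
    coeff α π s (star x) = α s (star (coeff α π s⁻¹ x)) := by
  refine ext_of_synth ((coeff α π s).continuous.comp continuous_star)
    ((map_continuous (α s)).comp (continuous_star.comp (coeff α π s⁻¹).continuous))
    (fun c => ?_) x
  simp only [Function.comp_def]
  induction c using Finsupp.induction_linear with
  | zero => simp
  | add c d hc hd => simp only [map_add, star_add, hc, hd]
  | single t a =>
    rw [star_synth_single, coeff_synth hπ, coeff_synth hπ]
    rcases eq_or_ne t s⁻¹ with rfl | ht
    · simp
    · rw [Finsupp.single_eq_of_ne' ht, Finsupp.single_eq_of_ne']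
      · simp
      · rintro rfl; simp at ht

theorem coeff_one (hπ : Function.Injective π) (s : Γ) [Decidable (s = 1)] :
    coeff α π s 1 = if s = 1 then 1 else 0 := by
  classical
  rw [one_eq_synth, coeff_synth hπ, Finsupp.single_apply]
  simp only [eq_comm]

end Coefficients

end ReducedCrossedProduct

/-- Writing `k = l* l`, the quadratic form of the Schur product at `ζ` is the sum over `r` of the
form of `Z` at the rescaled vectors `(l r p • ζ p)_p`. -/
theorem inner_matrixRep_schur_nonneg {C : Type*} [CStarAlgebra C] [PartialOrder C]
    [StarOrderedRing C] {K : Type*} [NormedAddCommGroup K] [InnerProductSpace ℂ K] [CompleteSpace K]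
    (π : C →⋆ₐ[ℂ] (K →L[ℂ] K)) {n : Type*} [Fintype n] {k : Matrix n n ℂ} (hk : k.PosSemidef)
    {Z : CStarMatrix n n C} (hZ : 0 ≤ Z) (ζ : PiLp 2 (fun _ : n => K)) :
    0 ≤ inner ℂ ζ (matrixRep π (CStarMatrix.ofMatrix fun p q => k p q • Z p q) ζ) := by
  classical
  obtain ⟨l, rfl⟩ : ∃ l : Matrix n n ℂ, k = l.conjTranspose * l := by
    open scoped MatrixOrder in
    exact CStarAlgebra.nonneg_iff_eq_star_mul_self.1 hk.nonneg
  have h (r : n) := inner_matrixRep_nonneg π hZ (WithLp.toLp 2 fun p => l r p • ζ p)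
  refine (Finset.sum_nonneg fun r (_ : r ∈ Finset.univ) => h r).trans_eq ?_
  simp only [inner_matrixRep_eq]
  rw [Finset.sum_comm]
  refine Finset.sum_congr rfl fun p _ => ?_
  rw [Finset.sum_comm]
  refine Finset.sum_congr rfl fun q _ => ?_
  change _ = inner ℂ (ζ p) (π ((l.conjTranspose * l) p q • Z p q) (ζ q))
  rw [map_smul, smul_apply, inner_smul_right, Matrix.mul_apply, Finset.sum_mul]
  refine Finset.sum_congr rfl fun r _ => ?_
  simp only [map_smul, inner_smul_left, inner_smul_right, Matrix.conjTranspose_apply,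
    starRingEnd_apply]
  ring

/-! ### Complete positivity through compressions to finite subsets of the group. -/

namespace ReducedCrossedProduct

variable {Γ : Type*} [Group Γ] {A : Type*} [CStarAlgebra A]
  {H : Type*} [NormedAddCommGroup H] [InnerProductSpace ℂ H] [CompleteSpace H]
  {α : Γ →* (A ≃⋆ₐ[ℂ] A)} {π : A →⋆ₐ[ℂ] (H →L[ℂ] H)}

/-- The ordered ring structure, stated for the ring structure that comes from the nonunital
C*-algebra structure, which instance search does not unify with the other one. -/
instance : @StarOrderedRing (ReducedCrossedProduct α π)
    (NonUnitalRing.toNonUnitalSemiring (self := NonUnitalNormedRing.toNonUnitalRing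
      (self := NonUnitalCStarAlgebra.toNonUnitalNormedRing))) _ NonUnitalCStarAlgebra.toStarRing :=
  instStarOrderedRing α π

section Positivity

variable {n : Type*} [Fintype n] {κ : Type*} [Fintype κ]

/-- The compression of a matrix of operators on `ℓ²(Γ, H)` to a finite family of points of `Γ`. -/
noncomputable def compress (γ : κ → Γ) (z : CStarMatrix n n (ReducedCrossedProduct α π)) :
    CStarMatrix (n × κ) (n × κ) A :=
  CStarMatrix.ofMatrix fun P Q =>
    α (γ P.2)⁻¹ (coeff α π (γ P.2 * (γ Q.2)⁻¹) (z P.1 Q.1))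

open Classical in
/-- The finitely supported vectors with values `ζ` at a finite family of points of `Γ`. -/
noncomputable def spread (γ : κ → Γ) (ζ : PiLp 2 (fun _ : n × κ => H)) :
    PiLp 2 (fun _ : n => L2Group Γ H) :=
  WithLp.toLp 2 fun p => ∑ k, lp.single 2 (γ k) (ζ (p, k))

theorem inner_single_left [DecidableEq Γ] (g : Γ) (v : H) (ξ : L2Group Γ H) :
    inner ℂ (lp.single 2 g v : L2Group Γ H) ξ = inner ℂ v (ξ g) := by
  rw [lp.inner_eq_tsum, tsum_eq_single g]
  · rw [lp.single_apply_self]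
  · intro h hh
    rw [lp.single_apply_ne _ _ _ hh, inner_zero_left]

theorem inner_matrixRep_spread (hπ : Function.Injective π) (γ : κ → Γ)
    (z : CStarMatrix n n (ReducedCrossedProduct α π)) (ζ : PiLp 2 (fun _ : n × κ => H)) :
    inner ℂ (spread γ ζ) (matrixRep (incl α π) z (spread γ ζ)) =
      inner ℂ ζ (matrixRep π (compress γ z) ζ) := by
  classical
  rw [inner_matrixRep_eq, inner_matrixRep_eq, Fintype.sum_prod_type]
  refine Finset.sum_congr rfl fun p _ => ?_
  have h (k : κ) : ∑ Q : n × κ, inner ℂ (ζ (p, k)) (π (compress γ z (p, k) Q) (ζ Q)) =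
      ∑ q, ∑ l, inner ℂ (ζ (p, k)) (π (compress γ z (p, k) (q, l)) (ζ (q, l))) :=
    Fintype.sum_prod_type _
  simp_rw [h]
  rw [Finset.sum_comm]
  refine Finset.sum_congr rfl fun q _ => ?_
  change inner ℂ (∑ k, lp.single 2 (γ k) (ζ (p, k)) : L2Group Γ H)
    (incl α π (z p q) (∑ l, lp.single 2 (γ l) (ζ (q, l)))) = _
  rw [map_sum, sum_inner]
  refine Finset.sum_congr rfl fun k _ => ?_
  rw [inner_sum]
  refine Finset.sum_congr rfl fun l _ => ?_
  rw [inner_single_left, incl_single_apply hπ]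
  rfl

theorem compress_nonneg [PartialOrder A] [StarOrderedRing A] (hπ : Function.Injective π)
    (γ : κ → Γ) {z : CStarMatrix n n (ReducedCrossedProduct α π)} (hz : 0 ≤ z) :
    0 ≤ compress γ z :=
  nonneg_of_inner_matrixRep_nonneg π hπ fun ζ => by
    rw [← inner_matrixRep_spread hπ]
    exact inner_matrixRep_nonneg _ hz _

/-- Truncating every coordinate to the same finite `F` approximates `ξ`, and the quadratic form is
continuous. -/
theorem nonneg_of_spread {z : CStarMatrix n n (ReducedCrossedProduct α π)}
    (h : ∀ (F : Finset Γ) (ζ : PiLp 2 (fun _ : n × F => H)),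
      0 ≤ inner ℂ (spread (Subtype.val : F → Γ) ζ)
        (matrixRep (incl α π) z (spread (Subtype.val : F → Γ) ζ))) : 0 ≤ z := by
  classical
  refine nonneg_of_inner_matrixRep_nonneg _ (incl_injective α π) fun ξ => ?_
  have hlim (p : n) : Tendsto (fun F : Finset Γ => ∑ g ∈ F, lp.single 2 g (ξ p g)) atTop
      (𝓝 (ξ p)) := lp.hasSum_single (by norm_num) (ξ p)
  rw [inner_matrixRep_eq]
  refine ge_of_tendsto' (tendsto_finsetSum _ fun p _ => tendsto_finsetSum _ fun q _ =>
    (hlim p).inner (((incl α π (z p q)).continuous.tendsto _).comp (hlim q))) fun F => ?_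
  have := h F (WithLp.toLp 2 fun P => ξ P.1 P.2)
  rw [inner_matrixRep_eq] at this
  refine this.trans_eq ?_
  refine Finset.sum_congr rfl fun p _ => Finset.sum_congr rfl fun q _ => ?_
  have hs (p : n) : spread (Subtype.val : F → Γ) (WithLp.toLp 2 fun P : n × F => ξ P.1 P.2) p =
      ∑ g ∈ F, lp.single 2 g (ξ p g) :=
    Finset.sum_coe_sort F fun g => (lp.single 2 g (ξ p g) : L2Group Γ H)
  rw [hs, hs]
  rfl

open Classical in
/-- A map which acts on the Fourier coefficients by a trace preserving conditional expectation
that is equivariant for a subgroup and by a positive definite function is completely positive. -/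
theorem nonneg_of_coeff_eq [PartialOrder A] [StarOrderedRing A] (hπ : Function.Injective π)
    {τ : A →ₚ[ℂ] ℂ} (hτ : IsFaithfulTracialState τ) (hinv : ∀ g a, τ (α g a) = τ a)
    {G : Subgroup Γ} {B : StarSubalgebra ℂ A} {E : A →ₗ[ℂ] A} (hE : IsTraceExpectation τ B E)
    (hBc : IsClosed (B : Set A)) (hB : ∀ g ∈ G, ∀ b ∈ B, α g b ∈ B)
    {f : Γ → ℂ} (hf : IsPositiveDefinite f) {x y : CStarMatrix n n (ReducedCrossedProduct α π)}
    (hxy : ∀ p q s, coeff α π s (y p q) = if s ∈ G then f s • E (coeff α π s (x p q)) else 0)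
    (hx : 0 ≤ x) : 0 ≤ y := by
  refine nonneg_of_spread fun F ζ => ?_
  rw [inner_matrixRep_spread hπ]
  set γ : F → Γ := Subtype.val
  have hZ := hE.matrix_nonneg α hτ hinv hBc hB (fun P : n × F => γ P.2) (compress_nonneg hπ γ hx)
  -- Positive definiteness concerns `f(s⁻¹t)`, while the compression involves `f(gh⁻¹)`; hence the
  -- inverses.
  have hk := hf.2.submatrix (fun P : n × F => (γ P.2)⁻¹)
  have := inner_matrixRep_schur_nonneg π hk hZ ζ
  convert this using 4
  refine CStarMatrix.ext fun P Q => ?_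
  change α (γ P.2)⁻¹ (coeff α π (γ P.2 * (γ Q.2)⁻¹) (y P.1 Q.1)) =
    f ((γ P.2)⁻¹⁻¹ * (γ Q.2)⁻¹) • (if γ P.2 * (γ Q.2)⁻¹ ∈ G then
      α (γ P.2)⁻¹ (E (α (γ P.2) (α (γ P.2)⁻¹ (coeff α π (γ P.2 * (γ Q.2)⁻¹) (x P.1 Q.1))))) else 0)
  rw [hxy, inv_inv, action_apply_inv_apply]
  split_ifs with h
  · rw [map_smul]
  · rw [map_zero, smul_zero]

end Positivity

/-! ### The canonical trace on the crossed product. -/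

section Trace

variable [PartialOrder A] [StarOrderedRing A]

/-- Only the products `u_s* u_t` with `s = t` contribute at the unit, and invariance of `τ` removes
the remaining twist. -/
theorem trace_star_synth_mul_synth (hπ : Function.Injective π) {τ : A →ₚ[ℂ] ℂ}
    (hinv : ∀ g a, τ (α g a) = τ a) (c d : Γ →₀ A) :
    τ (coeff α π 1 (star (synth α π c) * synth α π d)) = c.sum fun s a => τ (star a * d s) := by
  induction c using Finsupp.induction_linear with
  | zero => simp
  | add c c' hc hc' =>
    rw [map_add, star_add, add_mul, map_add, map_add, hc, hc', Finsupp.sum_add_index']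
    · simp
    · intro s a b; simp [add_mul]
  | single s a =>
    rw [Finsupp.sum_single_index (by simp)]
    induction d using Finsupp.induction_linear with
    | zero => simp
    | add d d' hd hd' =>
      rw [map_add, mul_add, map_add, map_add, hd, hd', Finsupp.add_apply, mul_add, map_add]
    | single t b =>
      rw [star_synth_single, synth_single_mul, coeff_synth hπ, ← map_mul]
      rcases eq_or_ne t s with rfl | hts
      · rw [inv_mul_cancel, Finsupp.single_eq_same, Finsupp.single_eq_same, hinv]
      · rw [Finsupp.single_eq_of_ne' hts, Finsupp.single_eq_of_ne', mul_zero]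
        intro h
        exact hts (inv_mul_eq_one.1 h).symm

theorem trace_mul_comm (hπ : Function.Injective π) {τ : A →ₚ[ℂ] ℂ}
    (hτ : IsFaithfulTracialState τ) (hinv : ∀ g a, τ (α g a) = τ a)
    (x y : ReducedCrossedProduct α π) :
    τ (coeff α π 1 (x * y)) = τ (coeff α π 1 (y * x)) := by
  have hcont : Continuous fun x : ReducedCrossedProduct α π => τ (coeff α π 1 x) :=
    (map_continuous τ).comp (coeff α π 1).continuous
  refine ext_of_synth (f := fun x => τ (coeff α π 1 (x * y)))
    (g := fun x => τ (coeff α π 1 (y * x))) (hcont.comp (continuous_mul_const y))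
    (hcont.comp (continuous_const_mul y)) (fun c => ?_) x
  refine ext_of_synth (f := fun y => τ (coeff α π 1 (synth α π c * y)))
    (g := fun y => τ (coeff α π 1 (y * synth α π c))) (hcont.comp (continuous_const_mul _))
    (hcont.comp (continuous_mul_const _)) (fun d => ?_) y
  induction c using Finsupp.induction_linear with
  | zero => simp
  | add c c' hc hc' => simp only [map_add, add_mul, mul_add, hc, hc']
  | single s a =>
    induction d using Finsupp.induction_linear with
    | zero => simp
    | add d d' hd hd' => simp only [map_add, add_mul, mul_add, hd, hd']
    | single t b =>
      simp only [synth_single_mul, coeff_synth hπ]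
      rcases eq_or_ne (s * t) 1 with h | h
      · obtain rfl : t = s⁻¹ := (inv_eq_of_mul_eq_one_right h).symm
        rw [h, inv_mul_cancel, Finsupp.single_eq_same, Finsupp.single_eq_same,
          hτ.map_mul_comm b, ← hinv s⁻¹, map_mul, action_inv_apply_apply]
      · have h' : t * s ≠ 1 := fun h' => h (mul_eq_one_comm.1 h')
        rw [Finsupp.single_eq_of_ne' h, Finsupp.single_eq_of_ne' h']

/-- A Bessel inequality: one term of a sum of nonnegative terms, extended by density. The case `s =
1` gives positivity of the trace; all `s` together give its faithfulness. -/
theorem trace_star_coeff_le (hπ : Function.Injective π) {τ : A →ₚ[ℂ] ℂ}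
    (hinv : ∀ g a, τ (α g a) = τ a) (s : Γ) (x : ReducedCrossedProduct α π) :
    τ (star (coeff α π s x) * coeff α π s x) ≤ τ (coeff α π 1 (star x * x)) := by
  have hτc := map_continuous τ
  refine (denseRange_synth α π).induction_on (p := fun x =>
    τ (star (coeff α π s x) * coeff α π s x) ≤ τ (coeff α π 1 (star x * x))) x
    (isClosed_le ?_ ?_) fun c => ?_
  · have := (coeff α π s).continuous
    exact hτc.comp (this.star.mul this)
  · exact hτc.comp ((coeff α π 1).continuous.comp (continuous_star.mul continuous_id))
  · rw [trace_star_synth_mul_synth hπ hinv, coeff_synth hπ]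
    by_cases hs : s ∈ c.support
    · exact Finset.single_le_sum (f := fun s => τ (star (c s) * c s))
        (fun t _ => τ.map_nonneg (star_mul_self_nonneg _)) hs
    · rw [Finsupp.notMem_support_iff.1 hs, mul_zero, map_zero]
      exact Finset.sum_nonneg fun t _ => τ.map_nonneg (star_mul_self_nonneg _)

/-- The canonical extension of an invariant trace to the reduced crossed product. -/
noncomputable def trace (hπ : Function.Injective π) (τ : A →ₚ[ℂ] ℂ)
    (hinv : ∀ g a, τ (α g a) = τ a) : ReducedCrossedProduct α π →ₚ[ℂ] ℂ :=
  positiveFunctional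
    ((τ : A →ₗ[ℂ] ℂ) ∘ₗ (coeff α π 1 : ReducedCrossedProduct α π →ₗ[ℂ] A)) fun b =>
      (τ.map_nonneg (star_mul_self_nonneg (coeff α π 1 b))).trans (trace_star_coeff_le hπ hinv 1 b)

theorem trace_apply (hπ : Function.Injective π) (τ : A →ₚ[ℂ] ℂ)
    (hinv : ∀ g a, τ (α g a) = τ a) (x : ReducedCrossedProduct α π) :
    trace hπ τ hinv x = τ (coeff α π 1 x) := rfl

theorem isCanonicalExtension_trace (hπ : Function.Injective π) (τ : A →ₚ[ℂ] ℂ)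
    (hinv : ∀ g a, τ (α g a) = τ a) : IsCanonicalExtension τ (trace hπ τ hinv) := by
  refine ⟨fun a => ?_, fun a s hs => ?_⟩
  · rw [trace_apply, ← synth_single, coeff_synth hπ, Finsupp.single_eq_same]
  · rw [trace_apply, ← synth_single, coeff_synth hπ, Finsupp.single_eq_of_ne' hs, map_zero]

theorem isFaithfulTracialState_trace (hπ : Function.Injective π) {τ : A →ₚ[ℂ] ℂ}
    (hτ : IsFaithfulTracialState τ) (hinv : ∀ g a, τ (α g a) = τ a) :
    IsFaithfulTracialState (trace hπ τ hinv) where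
  map_one := by
    rw [trace_apply, one_eq_synth, coeff_synth hπ, Finsupp.single_eq_same, hτ.map_one]
  map_mul_comm := trace_mul_comm hπ hτ hinv
  faithful x hx := by
    refine ext_coeff hπ fun s => ?_
    rw [map_zero]
    refine hτ.faithful _ (le_antisymm ?_ (τ.map_nonneg (star_mul_self_nonneg _)))
    exact (trace_star_coeff_le hπ hinv s x).trans_eq hx

end Trace

end ReducedCrossedProduct

/-! ### Norm bounds encoded in positivity of 2×2 matrices. -/

section Dilation

variable {C : Type*} [CStarAlgebra C] {K : Type*} [NormedAddCommGroup K] [InnerProductSpace ℂ K]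
  [CompleteSpace K] (π : C →⋆ₐ[ℂ] (K →L[ℂ] K))

/-- The matrix with the scalar `r` on the diagonal and `x`, `star x` off the diagonal. -/
def dilation (r : ℝ) (x : C) : CStarMatrix (Fin 2) (Fin 2) C :=
  CStarMatrix.ofMatrix !![(r : ℂ) • 1, x; star x, (r : ℂ) • 1]

theorem inner_matrixRep_dilation (r : ℝ) (x : C) (ξ : PiLp 2 (fun _ : Fin 2 => K)) :
    inner ℂ ξ (matrixRep π (dilation r x) ξ) =
      ((r * ‖ξ 0‖ ^ 2 + 2 * (inner ℂ (ξ 0) (π x (ξ 1))).re + r * ‖ξ 1‖ ^ 2 : ℝ) : ℂ) := by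
  rw [inner_matrixRep_eq, Fin.sum_univ_two, Fin.sum_univ_two, Fin.sum_univ_two]
  change inner ℂ (ξ 0) (π ((r : ℂ) • 1) (ξ 0)) + inner ℂ (ξ 0) (π x (ξ 1)) +
    (inner ℂ (ξ 1) (π (star x) (ξ 0)) + inner ℂ (ξ 1) (π ((r : ℂ) • 1) (ξ 1))) = _
  have h1 (v : K) : inner ℂ v (π ((r : ℂ) • 1) v) = ((r * ‖v‖ ^ 2 : ℝ) : ℂ) := by
    rw [map_smul, map_one, smul_apply, one_apply_eq_self, inner_smul_right,
      inner_self_eq_norm_sq_to_K]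
    simp
  have h2 : inner ℂ (ξ 1) (π (star x) (ξ 0)) = star (inner ℂ (ξ 0) (π x (ξ 1))) := by
    rw [map_star, ContinuousLinearMap.star_eq_adjoint, ContinuousLinearMap.adjoint_inner_right,
      ← inner_conj_symm]
    rfl
  rw [h1, h1, h2]
  apply Complex.ext
  · simp only [Complex.add_re, Complex.ofReal_re, Complex.star_def, Complex.conj_re]
    ring
  · simp only [Complex.add_im, Complex.ofReal_im, Complex.star_def, Complex.conj_im]
    ring

variable [PartialOrder C] [StarOrderedRing C]

theorem dilation_nonneg (hπ : Function.Injective π) {r : ℝ} {x : C} (h : ‖π x‖ ≤ r) :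
    0 ≤ dilation r x := by
  refine nonneg_of_inner_matrixRep_nonneg π hπ fun ξ => ?_
  rw [inner_matrixRep_dilation, Complex.zero_le_real]
  have h1 : -(inner ℂ (ξ 0) (π x (ξ 1))).re ≤ ‖ξ 0‖ * (r * ‖ξ 1‖) := by
    refine (neg_le_abs _).trans ((Complex.abs_re_le_norm _).trans
      ((norm_inner_le_norm _ _).trans ?_))
    gcongr
    exact (π x).le_of_opNorm_le h _
  have hr : 0 ≤ r := (norm_nonneg _).trans h
  nlinarith [mul_nonneg hr (sq_nonneg (‖ξ 0‖ - ‖ξ 1‖))]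

theorem norm_le_of_dilation_nonneg {r : ℝ} (hr : 0 < r) {x : C} (h : 0 ≤ dilation r x) :
    ‖π x‖ ≤ r := by
  refine ContinuousLinearMap.opNorm_le_bound _ hr.le fun v => ?_
  -- For a fixed second coordinate `v`, this first coordinate minimizes the quadratic form.
  have h1 := inner_matrixRep_nonneg π h (WithLp.toLp 2 ![-((r⁻¹ : ℝ) : ℂ) • π x v, v])
  rw [inner_matrixRep_dilation, Complex.zero_le_real] at h1
  have h2 : 0 ≤ r * ‖-((r⁻¹ : ℝ) : ℂ) • π x v‖ ^ 2 +
      2 * (inner ℂ (-((r⁻¹ : ℝ) : ℂ) • π x v) (π x v)).re + r * ‖v‖ ^ 2 := h1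
  have h3 : (inner ℂ (-((r⁻¹ : ℝ) : ℂ) • π x v) (π x v)).re = -(r⁻¹ * ‖π x v‖ ^ 2) := by
    rw [inner_smul_left, inner_self_eq_norm_sq_to_K, map_neg, Complex.conj_ofReal,
      RCLike.ofReal_eq_complex_ofReal, ← Complex.ofReal_pow, ← Complex.ofReal_neg,
      ← Complex.ofReal_mul, Complex.ofReal_re, neg_mul]
  rw [h3, norm_smul, norm_neg, Complex.norm_real, Real.norm_of_nonneg (by positivity)] at h2
  have h4 : r * (r⁻¹ * ‖π x v‖) ^ 2 = r⁻¹ * ‖π x v‖ ^ 2 := by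
    field_simp
  rw [h4] at h2
  have h5 : ‖π x v‖ ^ 2 ≤ (r * ‖v‖) ^ 2 := by
    have h6 : r⁻¹ * ‖π x v‖ ^ 2 ≤ r * ‖v‖ ^ 2 := by linarith
    rw [inv_mul_le_iff₀ hr] at h6
    calc _ ≤ _ := h6
      _ = _ := by ring
  exact le_of_sq_le_sq h5 (by positivity)

end Dilation

/-! ### GNS spaces, multiplier maps and their compactness. -/

section GNS

variable {C : Type*} [CStarAlgebra C] [PartialOrder C] [StarOrderedRing C] (t : C →ₚ[ℂ] ℂ)

theorem continuous_toPreGNS : Continuous t.toPreGNS := by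
  refine continuous_of_continuousAt_zero t.toPreGNS ?_
  rw [ContinuousAt, map_zero, tendsto_zero_iff_norm_tendsto_zero]
  have h : Continuous fun x : C => √(t (star x * x)).re :=
    Real.continuous_sqrt.comp (Complex.continuous_re.comp
      ((map_continuous t).comp (continuous_star.mul continuous_id)))
  have h0 := h.tendsto 0
  simp only [mul_zero, map_zero, Complex.zero_re, Real.sqrt_zero] at h0
  exact h0

/-- The canonical map of a C*-algebra to the GNS space of a positive functional. -/
noncomputable def toGNS : C →ₗ[ℂ] t.GNS :=
  (UniformSpace.Completion.toComplₗᵢ (𝕜 := ℂ) (E := t.PreGNS)).toLinearMap ∘ₗ t.toPreGNS.toLinearMap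

theorem norm_toGNS (x : C) : ‖toGNS t x‖ = ‖t.toPreGNS x‖ :=
  UniformSpace.Completion.norm_coe _

theorem continuous_toGNS : Continuous (toGNS t) :=
  (UniformSpace.Completion.continuous_coe _).comp (continuous_toPreGNS t)

theorem denseRange_toGNS : DenseRange (toGNS t) :=
  UniformSpace.Completion.denseRange_coe.comp t.toPreGNS.surjective.denseRange
    (UniformSpace.Completion.continuous_coe _)

theorem norm_toPreGNS_sq (x : C) : ((‖t.toPreGNS x‖ ^ 2 : ℝ) : ℂ) = t (star x * x) := by
  rw [Complex.ofReal_pow]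
  exact t.preGNS_norm_sq (t.toPreGNS x)

end GNS

theorem isCompactOperator_of_forall_mem {E F : Type*} [NormedAddCommGroup E] [NormedSpace ℂ E]
    [NormedAddCommGroup F] [NormedSpace ℂ F] (T : E →L[ℂ] F) (V : Submodule ℂ F)
    [FiniteDimensional ℂ V] (h : ∀ x, T x ∈ V) : IsCompactOperator T := by
  have : ProperSpace V := FiniteDimensional.proper ℂ V
  have h1 : IsCompactOperator (T.codRestrict V h) :=
    isCompactOperator_of_locallyCompactSpace_dom _
  exact h1.clm_comp V.subtypeL

section Multipliers

variable {Γ : Type*} {A : Type*} [CStarAlgebra A]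

/-- The map `∑ a_s u_s ↦ ∑ m(s) E(a_s) u_s` on coefficients. -/
noncomputable def coeffMap (m : Γ → ℂ) (E : A →ₗ[ℂ] A) : (Γ →₀ A) →ₗ[ℂ] (Γ →₀ A) :=
  Finsupp.lsum ℂ fun s => Finsupp.lsingle s ∘ₗ (m s • E)

theorem coeffMap_single (m : Γ → ℂ) (E : A →ₗ[ℂ] A) (s : Γ) (a : A) :
    coeffMap m E (Finsupp.single s a) = Finsupp.single s (m s • E a) := by
  rw [coeffMap, Finsupp.lsum_single]
  rfl

theorem coeffMap_apply (m : Γ → ℂ) (E : A →ₗ[ℂ] A) (c : Γ →₀ A) (s : Γ) :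
    coeffMap m E c s = m s • E (c s) := by
  induction c using Finsupp.induction_linear with
  | zero => simp
  | add c d hc hd => simp only [map_add, Finsupp.add_apply, hc, hd, smul_add]
  | single t a =>
    rw [coeffMap_single]
    rcases eq_or_ne t s with rfl | h
    · simp
    · rw [Finsupp.single_eq_of_ne' h, Finsupp.single_eq_of_ne' h, map_zero, smul_zero]

variable [PartialOrder A] [StarOrderedRing A] {τ : A →ₚ[ℂ] ℂ}

section Hilbert

/-- The map `σ` identifies the finitely supported functions `Γ → A` with a norm dense subspace of
`M`, on which the functional `t` is the orthogonal sum of copies of `τ`. -/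
structure IsOrthogonalSum {M : Type*} [CStarAlgebra M] [PartialOrder M] (τ : A →ₚ[ℂ] ℂ)
    (t : M →ₚ[ℂ] ℂ) (σ : (Γ →₀ A) →ₗ[ℂ] M) : Prop where
  dense : DenseRange σ
  apply_star_mul_self : ∀ c, t (star (σ c) * σ c) = c.sum fun s a => τ (star a * c s)

variable {M : Type*} [CStarAlgebra M] [PartialOrder M] [StarOrderedRing M] (t : M →ₚ[ℂ] ℂ)
  {σ : (Γ →₀ A) →ₗ[ℂ] M}

theorem norm_toPreGNS_synth_sq (hσ : IsOrthogonalSum τ t σ) (c : Γ →₀ A) {F : Finset Γ} (hF : c.support ⊆ F) :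
    ‖t.toPreGNS (σ c)‖ ^ 2 = ∑ s ∈ F, ‖τ.toPreGNS (c s)‖ ^ 2 := by
  apply Complex.ofReal_injective
  rw [norm_toPreGNS_sq, hσ.apply_star_mul_self, Complex.ofReal_sum, Finsupp.sum]
  simp_rw [norm_toPreGNS_sq]
  refine Finset.sum_subset hF fun s _ hs => ?_
  rw [Finsupp.notMem_support_iff.1 hs, mul_zero, map_zero]

theorem norm_toPreGNS_synth_single (hσ : IsOrthogonalSum τ t σ) (s : Γ) (a : A) :
    ‖t.toPreGNS (σ (Finsupp.single s a))‖ = ‖τ.toPreGNS a‖ := by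
  have h := norm_toPreGNS_synth_sq t hσ (Finsupp.single s a) Finsupp.support_single_subset
  rw [Finset.sum_singleton, Finsupp.single_eq_same] at h
  exact (pow_left_inj₀ (norm_nonneg _) (norm_nonneg _) two_ne_zero).1 h

theorem norm_toPreGNS_coeffMap_le (hσ : IsOrthogonalSum τ t σ) {B : StarSubalgebra ℂ A} {E : A →ₗ[ℂ] A}
    (hE : IsTraceExpectation τ B E) {m : Γ → ℂ} {r : ℝ} (hr : 0 ≤ r) (hm : ∀ s, ‖m s‖ ≤ r)
    (c : Γ →₀ A) :
    ‖t.toPreGNS (σ (coeffMap m E c))‖ ≤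
      r * ‖t.toPreGNS (σ c)‖ := by
  have hsupp : (coeffMap m E c).support ⊆ c.support := fun s hs => by
    rw [Finsupp.mem_support_iff] at hs ⊢
    intro h
    rw [coeffMap_apply, h, map_zero, smul_zero] at hs
    exact hs rfl
  refine le_of_sq_le_sq ?_ (mul_nonneg hr (norm_nonneg _))
  rw [mul_pow, norm_toPreGNS_synth_sq t hσ _ hsupp,
    norm_toPreGNS_synth_sq t hσ _ subset_rfl, Finset.mul_sum]
  refine Finset.sum_le_sum fun s _ => ?_
  rw [coeffMap_apply, map_smul, norm_smul, ← mul_pow]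
  have := hE.norm_toPreGNS_apply_le (c s)
  have := hm s
  gcongr

/-- The map `∑ a_s u_s ↦ ∑ m(s) E(a_s) u_s` on the GNS space. -/
noncomputable def hilbertMap (σ : (Γ →₀ A) →ₗ[ℂ] M) (m : Γ → ℂ) (E : A →ₗ[ℂ] A) :
    t.GNS →L[ℂ] t.GNS :=
  (toGNS t ∘ₗ σ ∘ₗ coeffMap m E).extendOfNorm (toGNS t ∘ₗ σ)

theorem denseRange_toGNS_synth (hσ : IsOrthogonalSum τ t σ) : DenseRange (toGNS t ∘ₗ σ) :=
  (denseRange_toGNS _).comp hσ.dense (continuous_toGNS _)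

theorem hilbertMap_synth (hσ : IsOrthogonalSum τ t σ) {B : StarSubalgebra ℂ A} {E : A →ₗ[ℂ] A}
    (hE : IsTraceExpectation τ B E) {m : Γ → ℂ} {r : ℝ} (hr : 0 ≤ r) (hm : ∀ s, ‖m s‖ ≤ r)
    (c : Γ →₀ A) :
    hilbertMap t σ m E (toGNS t (σ c)) =
      toGNS t (σ (coeffMap m E c)) := by
  have h (c : Γ →₀ A) : ‖(toGNS t ∘ₗ σ ∘ₗ coeffMap m E) c‖ ≤ r * ‖(toGNS t ∘ₗ σ) c‖ := by
    simp only [LinearMap.comp_apply]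
    rw [norm_toGNS, norm_toGNS]
    exact norm_toPreGNS_coeffMap_le t hσ hE hr hm c
  exact LinearMap.extendOfNorm_eq (f := toGNS t ∘ₗ σ ∘ₗ coeffMap m E) (e := toGNS t ∘ₗ σ)
    (denseRange_toGNS_synth t hσ) ⟨r, h⟩ c

theorem isCompactOperator_hilbertMap_of_finite (hσ : IsOrthogonalSum τ t σ) {B : StarSubalgebra ℂ A} [FiniteDimensional ℂ B]
    {E : A →ₗ[ℂ] A} (hE : IsTraceExpectation τ B E) {m : Γ → ℂ} {r : ℝ} (hr : 0 ≤ r)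
    (hm : ∀ s, ‖m s‖ ≤ r) (F : Finset Γ) (hF : ∀ s ∉ F, m s = 0) :
    IsCompactOperator (hilbertMap t σ m E) := by
  have : FiniteDimensional ℂ B.toSubalgebra.toSubmodule := ‹FiniteDimensional ℂ B›
  let e : (Γ →₀ A) →ₗ[ℂ] t.GNS := toGNS t ∘ₗ σ
  let V : Submodule ℂ t.GNS :=
    F.sup fun s => B.toSubalgebra.toSubmodule.map (e ∘ₗ Finsupp.lsingle s)
  have : FiniteDimensional ℂ V := Submodule.finiteDimensional_finset_sup F _
  refine isCompactOperator_of_forall_mem _ V fun x => ?_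
  refine (denseRange_toGNS_synth t hσ).induction_on
    (p := fun x => hilbertMap t σ m E x ∈ V) x
    (V.closed_of_finiteDimensional.preimage (hilbertMap t σ m E).continuous) fun c => ?_
  rw [LinearMap.comp_apply, hilbertMap_synth t hσ hE hr hm]
  induction c using Finsupp.induction_linear with
  | zero => simp
  | add c d hc hd => simp only [map_add]; exact add_mem hc hd
  | single s a =>
    rw [coeffMap_single]
    by_cases hs : s ∈ F
    · have hle : B.toSubalgebra.toSubmodule.map (e ∘ₗ Finsupp.lsingle s) ≤ V :=
        Finset.le_sup (f := fun s => B.toSubalgebra.toSubmodule.map (e ∘ₗ Finsupp.lsingle s)) hs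
      exact hle ⟨m s • E a, B.smul_mem (hE.mem a) _, rfl⟩
    · simp [hF s hs]

/-- Cutting `m` off outside the finite set where `‖m s‖ ≥ ε/2` leaves a finite rank operator, and
changes the operator norm by at most `ε/2`; compact operators are norm closed. -/
theorem isCompactOperator_hilbertMap (hσ : IsOrthogonalSum τ t σ) {B : StarSubalgebra ℂ A} [FiniteDimensional ℂ B]
    {E : A →ₗ[ℂ] A} (hE : IsTraceExpectation τ B E) {m : Γ → ℂ} (hm : Tendsto m cofinite (𝓝 0))
    {r : ℝ} (hr : 0 ≤ r) (hmr : ∀ s, ‖m s‖ ≤ r) : IsCompactOperator (hilbertMap t σ m E) := by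
  classical
  have hcl := isClosed_setOfPred_isCompactOperator (σ₁₂ := RingHom.id ℂ)
    (M₁ := t.GNS) (M₂ := t.GNS)
  refine hcl.closure_subset (Metric.mem_closure_iff.2 fun ε hε => ?_)
  have hfin : {s | ε / 2 ≤ ‖m s‖}.Finite := by
    have h1 : ∀ᶠ s in cofinite, ‖m s‖ < ε / 2 := by
      have := (tendsto_zero_iff_norm_tendsto_zero.1 hm).eventually (gt_mem_nhds (half_pos hε))
      exact this
    simpa [eventually_cofinite] using h1
  set F := hfin.toFinset
  let m' : Γ → ℂ := fun s => if s ∈ F then m s else 0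
  have hm' : ∀ s, ‖m' s‖ ≤ r := fun s => by
    simp only [m']
    split_ifs
    · exact hmr s
    · simpa using hr
  refine ⟨hilbertMap t σ m' E, isCompactOperator_hilbertMap_of_finite t hσ hE hr hm' F
    fun s hs => if_neg hs, ?_⟩
  rw [dist_eq_norm]
  refine lt_of_le_of_lt (ContinuousLinearMap.opNorm_le_bound _ (half_pos hε).le fun x => ?_)
    (half_lt_self hε)
  refine (denseRange_toGNS_synth t hσ).induction_on
    (p := fun x => ‖(hilbertMap t σ m E - hilbertMap t σ m' E) x‖ ≤ ε / 2 * ‖x‖) x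
    (isClosed_le (by fun_prop) (by fun_prop)) fun c => ?_
  rw [LinearMap.comp_apply, sub_apply, hilbertMap_synth t hσ hE hr hmr,
    hilbertMap_synth t hσ hE hr hm', ← map_sub, ← map_sub]
  have hsub : coeffMap m E c - coeffMap m' E c = coeffMap (m - m') E c := by
    ext s
    rw [Finsupp.sub_apply, coeffMap_apply, coeffMap_apply, coeffMap_apply, Pi.sub_apply, sub_smul]
  rw [hsub, norm_toGNS, norm_toGNS]
  refine norm_toPreGNS_coeffMap_le t hσ hE (half_pos hε).le (fun s => ?_) c
  by_cases hs : s ∈ F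
  · simp [m', hs, (half_pos hε).le]
  · have : ‖m s‖ < ε / 2 := by simpa [F] using hs
    simpa [m', hs] using this.le

end Hilbert

end Multipliers

section Multipliers

variable {Γ : Type*} {A : Type*} [CStarAlgebra A] [PartialOrder A] [StarOrderedRing A]
  {τ : A →ₚ[ℂ] ℂ} {M : Type*} [CStarAlgebra M] [PartialOrder M] [StarOrderedRing M]
  {t : M →ₚ[ℂ] ℂ} {σ : (Γ →₀ A) →ₗ[ℂ] M}

theorem isL2Compact_of_apply_eq_coeffMap (hσ : IsOrthogonalSum τ t σ) {B : StarSubalgebra ℂ A}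
    [FiniteDimensional ℂ B] {E : A →ₗ[ℂ] A} (hE : IsTraceExpectation τ B E) {m : Γ → ℂ}
    (hm : Tendsto m cofinite (𝓝 0)) {φ : M →CP M} (hφ : ∀ c, φ (σ c) = σ (coeffMap m E c))
    (hφ1 : ∀ x, ‖φ x‖ ≤ ‖x‖) : IsL2Compact t φ := by
  obtain ⟨r, hr⟩ := (tendsto_zero_iff_norm_tendsto_zero.1 hm).bddAbove_range_of_cofinite
  have hmr (s : Γ) : ‖m s‖ ≤ max r 0 := (hr ⟨s, rfl⟩).trans (le_max_left _ _)
  have hφc : Continuous φ := AddMonoidHomClass.continuous_of_bound φ 1 fun x => by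
    rw [one_mul]; exact hφ1 x
  refine ⟨hilbertMap t σ m E, fun x => ?_,
    isCompactOperator_hilbertMap t hσ hE hm (le_max_right r 0) hmr⟩
  refine hσ.dense.induction_on
    (p := fun x => hilbertMap t σ m E (toGNS t x) = toGNS t (φ x)) x
    (isClosed_eq ((hilbertMap t σ m E).continuous.comp (continuous_toGNS t))
      ((continuous_toGNS t).comp hφc)) fun c => ?_
  rw [hilbertMap_synth t hσ hE (le_max_right r 0) hmr, hφ]

variable {X : Type*} {l : Filter X} {m : X → Γ → ℂ} {B : X → StarSubalgebra ℂ A}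
  {E : X → A →ₗ[ℂ] A}

theorem tendsto_norm_toPreGNS_coeffMap_sub (hσ : IsOrthogonalSum τ t σ)
    (hE : ∀ i, IsTraceExpectation τ (B i) (E i)) (hm : ∀ s, Tendsto (fun i => m i s) l (𝓝 1))
    (hlim : ∀ a, Tendsto (fun i => ‖τ.toPreGNS (E i a - a)‖) l (𝓝 0)) (c : Γ →₀ A) :
    Tendsto (fun i => ‖t.toPreGNS (σ (coeffMap (m i) (E i) c) - σ c)‖) l (𝓝 0) := by
  induction c using Finsupp.induction_linear with
  | zero => simpa using tendsto_const_nhds (x := (0 : ℝ))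
  | add c d hc hd =>
    refine squeeze_zero (fun _ => norm_nonneg _) (fun i => ?_) (by simpa using hc.add hd)
    rw [map_add, map_add, map_add, add_sub_add_comm, map_add]
    exact norm_add_le _ _
  | single s a =>
    have h1 : Tendsto (fun i => ‖m i s - 1‖ * ‖τ.toPreGNS a‖) l (𝓝 0) := by
      have := ((hm s).sub_const 1).norm.mul_const ‖τ.toPreGNS a‖
      simpa using this
    refine squeeze_zero (fun _ => norm_nonneg _) (fun i => ?_)
      (by simpa using h1.add (hlim a))
    rw [coeffMap_single, ← map_sub, ← Finsupp.single_sub, norm_toPreGNS_synth_single t hσ]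
    have h2 : m i s • E i a - a = (m i s - 1) • E i a + (E i a - a) := by
      rw [sub_smul, one_smul]; abel
    rw [h2, map_add, map_smul]
    refine (norm_add_le _ _).trans (add_le_add_left ?_ _)
    rw [norm_smul]
    exact mul_le_mul_of_nonneg_left ((hE i).norm_toPreGNS_apply_le a) (norm_nonneg _)

/-- An `ε/3` argument: `x` is approximated in C*-norm by a finite sum. The `φ i` are uniformly
contractive for that norm, near zero of which the `L²`-norm is small. -/
theorem eventually_norm_toPreGNS_sub_lt (hσ : IsOrthogonalSum τ t σ)
    (hE : ∀ i, IsTraceExpectation τ (B i) (E i)) (hm : ∀ s, Tendsto (fun i => m i s) l (𝓝 1))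
    (hlim : ∀ a, Tendsto (fun i => ‖τ.toPreGNS (E i a - a)‖) l (𝓝 0)) {φ : X → (M →CP M)}
    (hφ : ∀ i c, φ i (σ c) = σ (coeffMap (m i) (E i) c)) (hφ1 : ∀ i x, ‖φ i x‖ ≤ ‖x‖)
    (x : M) {ε : ℝ} (hε : 0 < ε) : ∀ᶠ i in l, ‖t.toPreGNS (φ i x - x)‖ < ε := by
  have h0 : Tendsto (fun z : M => ‖t.toPreGNS z‖) (𝓝 0) (𝓝 0) := by
    have := (continuous_toPreGNS t).norm.tendsto 0
    simpa only [map_zero, norm_zero] using this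
  obtain ⟨δ, hδ, hδ'⟩ := Metric.eventually_nhds_iff.1
    (h0.eventually (gt_mem_nhds (show (0 : ℝ) < ε / 3 by linarith)))
  obtain ⟨c, hc⟩ := hσ.dense.exists_dist_lt x hδ
  rw [dist_eq_norm] at hc
  filter_upwards [(tendsto_norm_toPreGNS_coeffMap_sub hσ hE hm hlim c).eventually
    (gt_mem_nhds (show (0 : ℝ) < ε / 3 by linarith))] with i hi
  have h1 : ‖t.toPreGNS (x - σ c)‖ < ε / 3 := hδ' (by rwa [dist_zero_right])
  have h2 : ‖t.toPreGNS (φ i (x - σ c))‖ < ε / 3 :=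
    hδ' (by rw [dist_zero_right]; exact (hφ1 i _).trans_lt hc)
  have h3 : φ i x - x = φ i (x - σ c) + (σ (coeffMap (m i) (E i) c) - σ c) - (x - σ c) := by
    rw [map_sub, hφ]; abel
  rw [h3, map_sub, map_add]
  have h4 := norm_sub_le (t.toPreGNS (φ i (x - σ c)) +
    t.toPreGNS (σ (coeffMap (m i) (E i) c) - σ c)) (t.toPreGNS (x - σ c))
  have h5 := norm_add_le (t.toPreGNS (φ i (x - σ c)))
    (t.toPreGNS (σ (coeffMap (m i) (E i) c) - σ c))
  linarith

end Multipliers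

/-- Choosing one map per finite set and tolerance `1/(n+1)` reindexes the net by `Finset M × ℕ`,
which lies in the universe of `M`, unlike the index sets `I` and `J` in general. -/
theorem haagerupProperty_of_forall_finset {M : Type*} [CStarAlgebra M] [PartialOrder M]
    [StarOrderedRing M] {t : M →ₚ[ℂ] ℂ} (ht : IsFaithfulTracialState t)
    (h : ∀ (S : Finset M) (ε : ℝ), 0 < ε → ∃ φ : M →CP M, φ 1 = 1 ∧ (∀ x, t (φ x) = t x) ∧
      IsL2Compact t φ ∧ ∀ x ∈ S, ‖t.toPreGNS (φ x - x)‖ < ε) : HaagerupProperty t := by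
  classical
  choose φ h1 h2 h3 h4 using fun p : Finset M × ℕ =>
    h p.1 (1 / ((p.2 : ℝ) + 1)) Nat.one_div_pos_of_nat
  refine ⟨ht, Finset M × ℕ, inferInstance, inferInstance, inferInstance, φ, h1,
    fun p a _ => (h2 p a).le, fun a => ?_, h3⟩
  rw [Metric.tendsto_atTop]
  intro ε hε
  obtain ⟨N, hN⟩ := exists_nat_one_div_lt hε
  refine ⟨({a}, N), fun p hp => ?_⟩
  rw [Real.dist_eq, sub_zero, abs_of_nonneg (norm_nonneg _)]
  refine (h4 p a (hp.1 (Finset.mem_singleton_self a))).trans (lt_of_le_of_lt ?_ hN)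
  exact Nat.one_div_le_one_div hp.2

theorem IsPositiveDefinite.apply_inv {Γ : Type*} [Group Γ] {f : Γ → ℂ} (hf : IsPositiveDefinite f)
    (s : Γ) : star (f s⁻¹) = f s := by
  have := hf.2.isHermitian.apply 1 s
  simpa using this

/-! ### Construction of the approximating maps and conclusion. -/

namespace ReducedCrossedProduct

variable {Γ : Type*} [Group Γ] {A : Type*} [CStarAlgebra A] [PartialOrder A] [StarOrderedRing A]
  {H : Type*} [NormedAddCommGroup H] [InnerProductSpace ℂ H] [CompleteSpace H]
  {α : Γ →* (A ≃⋆ₐ[ℂ] A)} {π : A →⋆ₐ[ℂ] (H →L[ℂ] H)} {τ : A →ₚ[ℂ] ℂ}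

section Extension

variable {G : Subgroup Γ} {B : StarSubalgebra ℂ A} {E : A →ₗ[ℂ] A} {f : Γ → ℂ}

/-- For `r > ‖x‖` the matrix `dilation r x` is positive. The coefficient rule fixes its scalar
diagonal and respects the adjoint, so it sends this matrix to `dilation r y`, which is therefore
positive; hence `‖y‖ ≤ r`. -/
theorem norm_synth_coeffMap_le (hπ : Function.Injective π) (hτ : IsFaithfulTracialState τ)
    (hinv : ∀ g a, τ (α g a) = τ a) (hE : IsTraceExpectation τ B E) (hBc : IsClosed (B : Set A))
    (hB : ∀ g ∈ G, ∀ b ∈ B, α g b ∈ B) (hf : IsPositiveDefinite f) (c : Γ →₀ A) :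
    ‖synth α π (coeffMap ((G : Set Γ).indicator f) E c)‖ ≤ ‖synth α π c‖ := by
  classical
  refine le_of_forall_gt_imp_ge_of_dense fun r hr => ?_
  have hr0 : 0 < r := (norm_nonneg _).trans_lt hr
  set x := synth α π c with hx
  set y := synth α π (coeffMap ((G : Set Γ).indicator f) E c) with hy
  have hX : 0 ≤ dilation r x := dilation_nonneg (incl α π) (incl_injective α π) hr.le
  have hxy (s : Γ) : coeff α π s y = if s ∈ G then f s • E (coeff α π s x) else 0 := by
    rw [hx, hy, coeff_synth hπ, coeff_synth hπ, coeffMap_apply]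
    by_cases hs : s ∈ G
    · rw [if_pos hs, Set.indicator_of_mem (show s ∈ (G : Set Γ) from hs)]
    · rw [if_neg hs, Set.indicator_of_notMem (show s ∉ (G : Set Γ) from hs), zero_smul]
  have hdiag (s : Γ) : coeff α π s ((r : ℂ) • 1) =
      if s ∈ G then f s • E (coeff α π s ((r : ℂ) • 1)) else 0 := by
    rw [map_smul, coeff_one hπ]
    rcases eq_or_ne s 1 with rfl | hs
    · rw [if_pos rfl, if_pos G.one_mem, hf.1, one_smul, map_smul, hE.apply_of_mem hτ (one_mem B)]
    · simp [hs]
  -- The adjoint twists coefficients by `α s`; this is where equivariance of `E` under `G` and `star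
  -- (f s⁻¹) = f s` enter.
  have hstar (s : Γ) : coeff α π s (star y) =
      if s ∈ G then f s • E (coeff α π s (star x)) else 0 := by
    rw [coeff_star hπ, coeff_star hπ, hxy]
    by_cases hs : s ∈ G
    · rw [if_pos hs, if_pos (G.inv_mem hs), star_smul, hf.apply_inv, map_smul,
        ← hE.map_star_apply hτ, hE.comm hτ (α s) (hinv s) (hB s hs)]
      intro b hb
      rw [action_symm_apply]
      exact hB _ (G.inv_mem hs) b hb
    · rw [if_neg hs, if_neg (fun h => hs (by simpa using G.inv_mem h)), star_zero, map_zero]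
  have hY : 0 ≤ dilation r y := by
    refine nonneg_of_coeff_eq hπ hτ hinv hE hBc hB hf (fun p q s => ?_) hX
    fin_cases p <;> fin_cases q
    · exact hdiag s
    · exact hxy s
    · exact hstar s
    · exact hdiag s
  exact norm_le_of_dilation_nonneg (incl α π) hr0 hY

/-- The completely positive map `∑ a_s u_s ↦ ∑_{s ∈ G} f(s) E(a_s) u_s`. -/
theorem exists_completelyPositiveMap (hπ : Function.Injective π) (hτ : IsFaithfulTracialState τ)
    (hinv : ∀ g a, τ (α g a) = τ a) (hE : IsTraceExpectation τ B E) (hBc : IsClosed (B : Set A))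
    (hB : ∀ g ∈ G, ∀ b ∈ B, α g b ∈ B) (hf : IsPositiveDefinite f) :
    ∃ φ : ReducedCrossedProduct α π →CP ReducedCrossedProduct α π,
      (∀ c, φ (synth α π c) = synth α π (coeffMap ((G : Set Γ).indicator f) E c)) ∧
      (∀ x, ‖φ x‖ ≤ ‖x‖) ∧
      ∀ x s, coeff α π s (φ x) = (G : Set Γ).indicator f s • E (coeff α π s x) := by
  classical
  have hbound := norm_synth_coeffMap_le hπ hτ hinv hE hBc hB hf
  let ψ : ReducedCrossedProduct α π →L[ℂ] ReducedCrossedProduct α π :=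
    (synth α π ∘ₗ coeffMap ((G : Set Γ).indicator f) E).extendOfNorm (synth α π)
  have hψ (c : Γ →₀ A) : ψ (synth α π c) =
      synth α π (coeffMap ((G : Set Γ).indicator f) E c) :=
    LinearMap.extendOfNorm_eq (denseRange_synth α π)
      ⟨1, fun c => by rw [one_mul]; exact hbound c⟩ c
  have hψ1 (x : ReducedCrossedProduct α π) : ‖ψ x‖ ≤ ‖x‖ := by
    rw [← one_mul ‖x‖]
    exact LinearMap.norm_extendOfNorm_apply_le (denseRange_synth α π) 1
      (fun c => by rw [one_mul]; exact hbound c) x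
  have hcoeff (x : ReducedCrossedProduct α π) (s : Γ) :
      coeff α π s (ψ x) = (G : Set Γ).indicator f s • E (coeff α π s x) := by
    refine ext_of_synth (f := fun x => coeff α π s (ψ x))
      (g := fun x => (G : Set Γ).indicator f s • E (coeff α π s x))
      ((coeff α π s).continuous.comp ψ.continuous)
      (((hE.continuous hτ hBc).comp (coeff α π s).continuous).const_smul _) (fun c => ?_) x
    simp only [hψ, coeff_synth hπ, coeffMap_apply]
  refine ⟨⟨(ψ : ReducedCrossedProduct α π →ₗ[ℂ] ReducedCrossedProduct α π), fun k X hX => ?_⟩,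
    hψ, hψ1, hcoeff⟩
  refine nonneg_of_coeff_eq hπ hτ hinv hE hBc hB hf (fun p q s => ?_) hX
  refine (hcoeff (X p q) s).trans ?_
  by_cases hs : s ∈ G
  · rw [if_pos hs, Set.indicator_of_mem (show s ∈ (G : Set Γ) from hs)]
  · rw [if_neg hs, Set.indicator_of_notMem (show s ∉ (G : Set Γ) from hs), zero_smul]

end Extension

theorem isOrthogonalSum_synth (hπ : Function.Injective π) (hinv : ∀ g a, τ (α g a) = τ a) :
    IsOrthogonalSum τ (trace hπ τ hinv) (synth α π) :=
  ⟨denseRange_synth α π, fun c => trace_star_synth_mul_synth hπ hinv c c⟩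

end ReducedCrossedProduct

theorem tendsto_norm_toPreGNS_expectation_sub {A : Type*} [CStarAlgebra A] [PartialOrder A]
    [StarOrderedRing A] {τ : A →ₚ[ℂ] ℂ} (hτ : IsFaithfulTracialState τ) {I : Type*} [Preorder I]
    {S : I → Set A} (hS : Monotone S)
    (hdense : Dense {x : τ.PreGNS | ∃ i, ∃ a ∈ S i, τ.toPreGNS a = x})
    {B : I → StarSubalgebra ℂ A} (hSB : ∀ i, S i ⊆ B i) {E : I → A →ₗ[ℂ] A}
    (hE : ∀ i, IsTraceExpectation τ (B i) (E i)) (a : A) :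
    Tendsto (fun i => ‖τ.toPreGNS (E i a - a)‖) atTop (𝓝 0) := by
  rw [Metric.tendsto_nhds]
  intro ε hε
  obtain ⟨x, ⟨i, b, hb, rfl⟩, hx⟩ := hdense.exists_dist_lt (τ.toPreGNS a) (half_pos hε)
  filter_upwards [eventually_ge_atTop i] with j hj
  rw [Real.dist_eq, sub_zero, abs_of_nonneg (norm_nonneg _)]
  -- The factor 2 in this bound is why `b` was chosen within `ε/2` of `a`.
  refine ((hE j).norm_toPreGNS_apply_sub_le hτ a (hSB j (hS hj hb))).trans_lt ?_
  rw [dist_eq_norm, ← map_sub] at hx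
  linarith

theorem mainTheorem9
    {Γ : Type*} [Group Γ] (hΓ : GroupHaagerup Γ)
    {A : Type*} [CStarAlgebra A] [PartialOrder A] [StarOrderedRing A]
    (α : Γ →* (A ≃⋆ₐ[ℂ] A))
    -- a `Γ`-invariant faithful tracial state
    (τ : A →ₚ[ℂ] ℂ) (hτ : IsFaithfulTracialState τ) (hinv : ∀ g a, τ (α g a) = τ a)
    -- the increasing net of subgroups
    {I : Type*} [Preorder I] [IsDirectedOrder I]
    (Γi : I → Subgroup Γ) (hΓi : Monotone Γi) (hΓcov : ∀ g : Γ, ∃ i, g ∈ Γi i)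
    -- the increasing net of finite dimensional C*-subalgebras
    (Ai : I → NonUnitalStarSubalgebra ℂ A) (hAi : Monotone Ai)
    (hfin : ∀ i, FiniteDimensional ℂ (Ai i))
    (hdense : Dense {x : τ.PreGNS | ∃ i, ∃ a ∈ Ai i, τ.toPreGNS a = x})
    (hAinv : ∀ i, ∀ g ∈ Γi i, ∀ a ∈ Ai i, α g a ∈ Ai i)
    -- any faithful representation of `A`, used to realize the reduced crossed product
    {H : Type*} [NormedAddCommGroup H] [InnerProductSpace ℂ H] [CompleteSpace H]
    (π : A →⋆ₐ[ℂ] (H →L[ℂ] H)) (hπ : Function.Injective π) :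
    ∃ τ' : ReducedCrossedProduct α π →ₚ[ℂ] ℂ,
      ReducedCrossedProduct.IsCanonicalExtension τ τ' ∧ HaagerupProperty τ' := by
  refine ⟨ReducedCrossedProduct.trace hπ τ hinv,
    ReducedCrossedProduct.isCanonicalExtension_trace hπ τ hinv, ?_⟩
  refine haagerupProperty_of_forall_finset
    (ReducedCrossedProduct.isFaithfulTracialState_trace hπ hτ hinv) fun S ε hε => ?_
  obtain ⟨J, _, _, _, f, hfpd, hf0, hf1⟩ := hΓ
  have : Nonempty I := (hΓcov 1).nonempty
  -- `Ai i` need not contain the unit of `A`; enlarging it makes `E i`, and hence the resulting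
  -- maps, unital.
  let B (i : I) : StarSubalgebra ℂ A := StarAlgebra.adjoin ℂ (Ai i : Set A)
  have hBfin (i : I) : FiniteDimensional ℂ (B i) := finiteDimensional_adjoin (Ai i)
  have hBc (i : I) : IsClosed (B i : Set A) := isClosed_of_finiteDimensional (B i)
  have hBinv (i : I) : ∀ g ∈ Γi i, ∀ b ∈ B i, α g b ∈ B i := fun g hg b hb =>
    apply_mem_adjoin (α g) (hAinv i g hg) hb
  choose E hE using fun i => exists_isTraceExpectation hτ (B i)
  choose φ hφ hφ1 hφcoeff using fun p : I × J =>
    ReducedCrossedProduct.exists_completelyPositiveMap hπ hτ hinv (hE p.1) (hBc p.1) (hBinv p.1)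
      (hfpd p.2)
  have hσ := ReducedCrossedProduct.isOrthogonalSum_synth hπ hinv
  have hm (s : Γ) : Tendsto (fun p : I × J => (Γi p.1 : Set Γ).indicator (f p.2) s)
      (atTop ×ˢ atTop) (𝓝 1) := by
    obtain ⟨i, hi⟩ := hΓcov s
    refine ((hf1 s).comp tendsto_snd).congr' ?_
    filter_upwards [tendsto_fst.eventually (eventually_ge_atTop i)] with p hp
    exact (Set.indicator_of_mem (show s ∈ (Γi p.1 : Set Γ) from hΓi hp hi) _).symm
  have hlim (a : A) : Tendsto (fun p : I × J => ‖τ.toPreGNS (E p.1 a - a)‖)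
      (atTop ×ˢ atTop) (𝓝 0) :=
    (tendsto_norm_toPreGNS_expectation_sub hτ (S := fun i => (Ai i : Set A)) hAi hdense
      (fun i => StarAlgebra.subset_adjoin ℂ _) hE a).comp tendsto_fst
  have hev := (Finset.eventually_all S).2 fun x _ =>
    eventually_norm_toPreGNS_sub_lt hσ (fun p : I × J => hE p.1) hm hlim hφ hφ1 x hε
  -- Nonemptiness and directedness of `I` and `J` make the product filter nontrivial, so one index
  -- serves all of `S`.
  obtain ⟨p, hp⟩ := hev.exists
  refine ⟨φ p, ?_, fun x => ?_, ?_, hp⟩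
  · rw [ReducedCrossedProduct.one_eq_synth, hφ, coeffMap_single,
      Set.indicator_of_mem (one_mem (Γi p.1)), (hfpd p.2).1, one_smul,
      (hE p.1).apply_of_mem hτ (one_mem _)]
  · rw [ReducedCrossedProduct.trace_apply, ReducedCrossedProduct.trace_apply, hφcoeff,
      Set.indicator_of_mem (one_mem (Γi p.1)), (hfpd p.2).1, one_smul, (hE p.1).trace_apply]
  · refine isL2Compact_of_apply_eq_coeffMap hσ (hE p.1) ?_ (hφ p) (hφ1 p)
    -- Restricting `f` to the subgroup only decreases absolute values, so it still vanishes at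
    -- infinity.
    refine squeeze_zero_norm (fun s => ?_) (tendsto_zero_iff_norm_tendsto_zero.1 (hf0 p.2))
    exact norm_indicator_le_norm_self _ _
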